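/- **Theorem 1.2.** Let $G$ be a locally compact (Hausdorff) group with strong Property (T) with respect to Hilbert spaces, and let $X$ be a uniformly fine Gromov-hyperbolic (simplicial) graph. Suppose that $G$ acts on the vertex set of $X$ by isometries of the graph metric $d$, continuously in the sense that the stabilizer of every vertex is open. Then every orbit of $G$ on the vertex set of $X$ is bounded. Here the notions are as follows. * A *length function* on $G$ is a continuous function $l\colon G\to[0,\infty)$ with $l(g^{-1})=l(g)$ and $l(gh)\le l(g)+l(h)$ for all $g,h\in G$. * $G$ has *strong Property (T) with respect to Hilbert spaces* if for every length function $l$ on $G$ there is a sequence $(m_n)$ of compactly supported symmetric (i.e. invariant under $g\mapsto g^{-1}$) finite signed Borel measures on $G$ such that for every complex Hilbert space $H$ there is a constant $t>0$ with the following property: for every strongly continuous representation $\pi$ of $G$ on $H$ by bounded operators satisfying $\|\pi(g)\|\le L\,e^{t\,l(g)}$ for all $g\in G$ and some $L\ge 0$, the operators $\pi(m_n)=\int_G\pi(g)\,dm_n(g)$ converge in operator norm to a (not necessarily orthogonal) projection onto the space of $\pi(G)$-invariant vectors of $H$. * A graph $X$ is *Gromov-hyperbolic* if it is connected and there is $\delta>0$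 such that in every geodesic triangle each side is contained in the $\delta$-neighbourhood of the union of the other two sides. * A graph $X$ is *uniformly fine* if there is a function $\varphi\colon\mathbb N\to\mathbb N$ such that for every edge $e$ and every $L\in\mathbb N$ there are at most $\varphi(L)$ simple simplicial loops of length at most $L$ in $X$ that contain $e$. (Such a graph may be locally infinite.) -/

import Mathlib

open Filter Topology MeasureTheory

universe u

/-- A length function on a topological group: a continuous, non-negative, symmetric and
subadditive real function. -/
structure IsLengthFunction {G : Type*} [Group G] [TopologicalSpace G] (l : G → ℝ) : Prop where
  continuous : Continuous l
  nonneg : ∀ g, 0 ≤ l g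
  symm : ∀ g, l g⁻¹ = l g
  mul_le : ∀ g h, l (g * h) ≤ l g + l h

/-- A (finite, signed) Borel measure is symmetric if it is invariant under `g ↦ g⁻¹`. -/
def IsSymmetricMeasure {G : Type*} [Group G] [MeasurableSpace G] (m : SignedMeasure G) : Prop :=
  ∀ A : Set G, MeasurableSet A → m A⁻¹ = m A

/-- A signed measure is compactly supported if it vanishes on all measurable sets that are
disjoint from some fixed compact set. -/
def IsCompactlySupportedMeasure {G : Type*} [TopologicalSpace G] [MeasurableSpace G]
    (m : SignedMeasure G) : Prop :=
  ∃ K : Set G, IsCompact K ∧ ∀ A : Set G, MeasurableSet A → Disjoint A K → m A = 0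

/-- The (Bochner) integral `∫ f dm = ∫ f dm⁺ - ∫ f dm⁻` of a vector-valued function against a
signed measure with Jordan decomposition `m = m⁺ - m⁻`. -/
noncomputable def signedIntegral {G : Type*} [MeasurableSpace G] {H : Type*}
    [NormedAddCommGroup H] [NormedSpace ℝ H] (m : SignedMeasure G) (f : G → H) : H :=
  (∫ g, f g ∂m.toJordanDecomposition.posPart) - ∫ g, f g ∂m.toJordanDecomposition.negPart

/-- A representation of `G` by bounded operators on `H` is strongly continuous if all its orbit
maps are continuous. -/
def IsStronglyContinuous {G : Type*} [Group G] [TopologicalSpace G] {H : Type*}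
    [NormedAddCommGroup H] [InnerProductSpace ℂ H] (π : G →* (H →L[ℂ] H)) : Prop :=
  ∀ ξ : H, Continuous fun g => π g ξ

/-- `T` is the operator `π(m) = ∫ π(g) dm(g)`. When `π` is strongly continuous and `m` is
compactly supported, the integrand is integrable, so this is a genuine integral. -/
def IsIntegratedOperator {G : Type*} [Group G] [MeasurableSpace G] {H : Type*}
    [NormedAddCommGroup H] [InnerProductSpace ℂ H] (π : G →* (H →L[ℂ] H))
    (m : SignedMeasure G) (T : H →L[ℂ] H) : Prop :=
  ∀ ξ : H, T ξ = signedIntegral m fun g => π g ξ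

/-- `P` is a (not necessarily orthogonal) projection onto the space of `π(G)`-invariant vectors:
it takes values in that space and it is the identity on it. -/
def IsProjectionOntoInvariants {G : Type*} [Group G] {H : Type*}
    [NormedAddCommGroup H] [InnerProductSpace ℂ H] (π : G →* (H →L[ℂ] H))
    (P : H →L[ℂ] H) : Prop :=
  (∀ ξ g, π g (P ξ) = P ξ) ∧ ∀ ξ, (∀ g, π g ξ = ξ) → P ξ = ξ

/-- Strong Property (T) with respect to (complex) Hilbert spaces: for every length function `l`
there is a sequence `m n` of compactly supported symmetric Borel measures such that for every
Hilbert space `H` there is `t > 0` such that, for every strongly continuous representation `π` of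
`G` on `H` with `‖π g‖ ≤ L * exp (t * l g)` for some `L ≥ 0`, the operators `π(m n)` converge in
operator norm to a projection onto the invariant vectors. -/
def HasStrongPropertyT (G : Type u) [Group G] [TopologicalSpace G] [MeasurableSpace G] : Prop :=
  ∀ l : G → ℝ, IsLengthFunction l →
    ∃ m : ℕ → SignedMeasure G,
      (∀ n, IsCompactlySupportedMeasure (m n) ∧ IsSymmetricMeasure (m n)) ∧
      ∀ (H : Type u) [NormedAddCommGroup H] [InnerProductSpace ℂ H] [CompleteSpace H],
        ∃ t : ℝ, 0 < t ∧
          ∀ π : G →* (H →L[ℂ] H), IsStronglyContinuous π →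
            (∃ L : ℝ, 0 ≤ L ∧ ∀ g, ‖π g‖ ≤ L * Real.exp (t * l g)) →
            ∃ (T : ℕ → H →L[ℂ] H) (P : H →L[ℂ] H),
              (∀ n, IsIntegratedOperator π (m n) (T n)) ∧
              IsProjectionOntoInvariants π P ∧
              Tendsto T atTop (𝓝 P)

namespace SimpleGraph

variable {V : Type*} (X : SimpleGraph V)

/-- A walk in a graph is a geodesic if its length is the distance of its endpoints. -/
def IsGeodesicWalk {X : SimpleGraph V} {x y : V} (p : X.Walk x y) : Prop :=
  p.length = X.dist x y

/-- All geodesic triangles are `δ`-thin: each side is contained in the `δ`-neighbourhood of the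
union of the other two. (As the corners can be permuted, it suffices to speak of one side.) -/
def IsDeltaThin (δ : ℝ) : Prop :=
  ∀ (x y z : V) (p : X.Walk x y) (q : X.Walk y z) (r : X.Walk x z),
    IsGeodesicWalk p → IsGeodesicWalk q → IsGeodesicWalk r →
    ∀ a ∈ p.support, ∃ b, (b ∈ q.support ∨ b ∈ r.support) ∧ (X.dist a b : ℝ) ≤ δ

/-- A Gromov-hyperbolic graph: a connected graph whose geodesic triangles are `δ`-thin for some
`δ > 0`. -/
def IsGromovHyperbolic : Prop :=
  X.Connected ∧ ∃ δ : ℝ, 0 < δ ∧ X.IsDeltaThin δ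

/-- The simple loops (cycles, as subgraphs of `X`) of length at most `L` that contain the
edge `e`. -/
def simpleLoopsThrough (e : Sym2 V) (L : ℕ) : Set X.Subgraph :=
  {C | ∃ (v : V) (p : X.Walk v v),
    p.IsCycle ∧ p.length ≤ L ∧ e ∈ p.edges ∧ C = p.toSubgraph}

/-- A graph is uniformly fine if the number of simple loops of length at most `L` through an edge
is finite and bounded by a function of `L` only. -/
def IsUniformlyFine : Prop :=
  ∃ φ : ℕ → ℕ, ∀ e ∈ X.edgeSet, ∀ L : ℕ, (X.simpleLoopsThrough e L).encard ≤ φ L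

end SimpleGraph

/-! Two vertices lie in the same cone of level `n` around `x` if their distance functions differ by
a constant on the ball of radius `n` around `x`. The cones of each level partition the vertices,
those of level `n + 1` (the children) refine those of level `n`, and at level `0` there is only one.
The energy at `x` of a finitely supported function is the sum of the squares of its masses on all
cones around `x`. It is the square of a Hilbert semi-norm, and an isometry `g` carries the energy at
`x` to the energy at `gx`. Two estimates carry the theorem. By `exists_energyLE_change`, passing
from `x'` to `x` multiplies energies at most by a polynomial in `d(x, x')`. By
`exists_dist_mul_norm_sq_mass_univ_le`, a function with energies at most `E` at `x` and `x'` has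
total mass `s` with `d(x, x') |s|² ≤ K E`.

By the first estimate, `G` acts on the completion with norms polynomial in `l(g) = d(x, gx)`, hence
below any exponential. The total mass is a bounded invariant functional, so strong Property (T)
yields an invariant vector of total mass 1 (`HasStrongPropertyT.exists_invariant`). Functions
approximating it have bounded energy at `x` and at `gx` and total mass at least 1/2, so the second
estimate bounds `d(x, gx)`.

As the graph may be locally infinite, all finiteness comes from fineness. Geodesics to a vertex
behind an edge `ab` cross a bounded set of vertices on short loops through `ab`, so boundedly many
cones lie behind `b` (`exists_cone_cover`). The steps at a small angle to a given edge are boundedly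
many, while a large angle at a vertex forces geodesics through that vertex. Hence all but boundedly
many children of a cone around `x'` lie on the same side of a cone around `x`
(`exists_children_cover`), and the mass of an intersection of such cones is controlled by boundedly
many cones around `x'` (`exists_dominated_inter`).

Thus a cone around `x` that does not look towards `x'` is controlled by boundedly many cones around
`x'`, each serving boundedly often. With `D = d(x, x')`, there are `O(D + 1)` cones that do look
towards `x'`, each of mass `O((D + 1)√E)`. For the second estimate, every level between `x` and `x'`
splits the graph into a part controlled from `x` and a part controlled from `x'`; summing over the
levels produces the factor `D`. -/

namespace SimpleGraph

/-- `p` lies on a geodesic from `x` to `y`. -/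
def Btw {V : Type*} (X : SimpleGraph V) (x p y : V) : Prop :=
  X.dist x p + X.dist p y = X.dist x y

/-! ### Geodesics and intervals -/

section Btw

variable {V : Type*} {X : SimpleGraph V}

theorem btw_left (x y : V) : X.Btw x x y := by simp [Btw]

theorem btw_right (x y : V) : X.Btw x y y := by simp [Btw]

theorem Btw.symm {x p y : V} (h : X.Btw x p y) : X.Btw y p x := by
  unfold Btw at *
  rw [X.dist_comm (u := y) (v := p), X.dist_comm (u := p) (v := x),
    X.dist_comm (u := y) (v := x)]
  omega

theorem Btw.trans_left (hc : X.Connected) {x q p y : V} (h : X.Btw x p y) (h' : X.Btw x q p) :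
    X.Btw x q y := by
  unfold Btw at *
  have h1 := hc.dist_triangle (u := x) (v := q) (w := y)
  have h2 := hc.dist_triangle (u := q) (v := p) (w := y)
  omega

theorem Btw.trans_mid (hc : X.Connected) {x q p y : V} (h : X.Btw x p y) (h' : X.Btw x q p) :
    X.Btw q p y := by
  unfold Btw at *
  have h1 := hc.dist_triangle (u := x) (v := q) (w := y)
  have h2 := hc.dist_triangle (u := q) (v := p) (w := y)
  omega

theorem Btw.trans_right (hc : X.Connected) {x q p y : V} (h : X.Btw x q y) (h' : X.Btw q p y) :
    X.Btw x p y :=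
  (h.symm.trans_left hc h'.symm).symm

theorem Btw.trans_mid' (hc : X.Connected) {x q p y : V} (h : X.Btw x q y) (h' : X.Btw q p y) :
    X.Btw x q p :=
  (h.symm.trans_mid hc h'.symm).symm

theorem IsGeodesicWalk.btw (hc : X.Connected) {x y v : V} {w : X.Walk x y}
    (hw : IsGeodesicWalk w) (hv : v ∈ w.support) : X.Btw x v y := by
  classical
  have h1 := dist_le (w.takeUntil v hv)
  have h2 := dist_le (w.dropUntil v hv)
  have h3 : (w.takeUntil v hv).length + (w.dropUntil v hv).length = w.length := by
    rw [← Walk.length_append, Walk.take_spec]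
  have h4 := hc.dist_triangle (u := x) (v := v) (w := y)
  unfold IsGeodesicWalk at hw
  unfold Btw
  omega

theorem exists_geodesicWalk (hc : X.Connected) (x y : V) :
    ∃ w : X.Walk x y, IsGeodesicWalk w :=
  hc.exists_walk_length_eq_dist x y

/-- A geodesic walk inside the interval between two vertices. -/
theorem exists_walk_btw (hc : X.Connected) (x y : V) :
    ∃ w : X.Walk x y, w.length = X.dist x y ∧ ∀ v ∈ w.support, X.Btw x v y := by
  obtain ⟨w, hw⟩ := exists_geodesicWalk hc x y
  exact ⟨w, hw, fun v hv => hw.btw hc hv⟩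

theorem exists_geodesicWalk_through (hc : X.Connected) {x p y : V} (h : X.Btw x p y) :
    ∃ w : X.Walk x y, IsGeodesicWalk w ∧ p ∈ w.support := by
  obtain ⟨w₁, h₁⟩ := exists_geodesicWalk hc x p
  obtain ⟨w₂, h₂⟩ := exists_geodesicWalk hc p y
  refine ⟨w₁.append w₂, ?_, by simp⟩
  unfold IsGeodesicWalk at *
  rw [Walk.length_append, h₁, h₂, h]

theorem exists_btw_dist_eq (hc : X.Connected) {x y : V} {n : ℕ} (hn : n ≤ X.dist x y) :
    ∃ p, X.Btw x p y ∧ X.dist x p = n := by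
  obtain ⟨w, hw⟩ := exists_geodesicWalk hc x y
  refine ⟨w.getVert n, hw.btw hc (w.getVert_mem_support n), ?_⟩
  have h1 := dist_le (w.take n)
  have h2 := dist_le (w.drop n)
  have h3 : (w.take n).length + (w.drop n).length = w.length := by
    rw [← Walk.length_append, Walk.append_take_drop_eq]
  have h4 := hc.dist_triangle (u := x) (v := w.getVert n) (w := y)
  have h5 : (w.take n).length ≤ n := by rw [Walk.take_length]; omega
  have h6 : (w.drop n).length = w.length - n := by simp
  unfold IsGeodesicWalk at hw
  omega

theorem exists_adj_btw (hc : X.Connected) {x y : V} (h : x ≠ y) :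
    ∃ b, X.Adj x b ∧ X.Btw x b y := by
  obtain ⟨b, hb, hb'⟩ := exists_btw_dist_eq hc (hc.pos_dist_of_ne h)
  exact ⟨b, dist_eq_one_iff_adj.1 hb', hb⟩

theorem IsGeodesicWalk.exists_subwalk {x y a b : V} {w : X.Walk x y}
    (hw : IsGeodesicWalk w) (ha : a ∈ w.support) (hb : b ∈ w.support) :
    ∃ r : X.Walk a b, r.length = X.dist a b ∧ ∀ v ∈ r.support, v ∈ w.support := by
  classical
  have key : ∀ {c d : V} (r : X.Walk c d), r.IsSubwalk w → r.length = X.dist c d :=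
    fun r hr => length_eq_dist_of_subwalk hw hr
  have hab : b ∈ ((w.takeUntil a ha).append (w.dropUntil a ha)).support := by
    rwa [Walk.take_spec]
  rcases (Walk.mem_support_append_iff _ _).1 hab with h | h
  · have hs : ((w.takeUntil a ha).dropUntil b h).IsSubwalk w :=
      (Walk.isSubwalk_dropUntil _ _).trans (Walk.isSubwalk_takeUntil _ _)
    refine ⟨((w.takeUntil a ha).dropUntil b h).reverse, ?_, ?_⟩
    · rw [Walk.length_reverse, key _ hs, dist_comm]
    · intro v hv
      rw [Walk.support_reverse, List.mem_reverse] at hv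
      exact hs.support_subset hv
  · have hs : ((w.dropUntil a ha).takeUntil b h).IsSubwalk w :=
      (Walk.isSubwalk_takeUntil _ _).trans (Walk.isSubwalk_dropUntil _ _)
    exact ⟨_, key _ hs, fun v hv => hs.support_subset hv⟩

end Btw

/-- Geodesic triangles with two given sides are `κ`-thin. -/
def ThinWalks {V : Type*} (X : SimpleGraph V) (κ : ℕ) : Prop :=
  ∀ (x p y z : V) (q : X.Walk y z) (r : X.Walk x z), X.Btw x p y → IsGeodesicWalk q →
    IsGeodesicWalk r → ∃ b, (b ∈ q.support ∨ b ∈ r.support) ∧ X.dist p b ≤ κ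

/-- The four-point condition. -/
def FourPoint {V : Type*} (X : SimpleGraph V) (κ : ℕ) : Prop :=
  ∀ x y z w : V, X.dist x y + X.dist z w ≤ X.dist x z + X.dist y w + κ ∨
    X.dist x y + X.dist z w ≤ X.dist x w + X.dist y z + κ

/-! ### Thin triangles and the four-point condition -/

section Hyperbolic

variable {V : Type*} {X : SimpleGraph V}

theorem IsDeltaThin.thinWalks (hc : X.Connected) {δ : ℝ} (h : X.IsDeltaThin δ) :
    X.ThinWalks ⌊δ⌋₊ := by
  intro x p y z q r hp hq hr
  obtain ⟨w, hw, hpw⟩ := exists_geodesicWalk_through hc hp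
  obtain ⟨b, hb, hd⟩ := h x y z w q r hw hq hr p hpw
  exact ⟨b, hb, Nat.le_floor hd⟩

theorem ThinWalks.mono {κ κ' : ℕ} (h : X.ThinWalks κ) (hκ : κ ≤ κ') : X.ThinWalks κ' := by
  intro x p y z q r hp hq hr
  obtain ⟨b, hb, hd⟩ := h x p y z q r hp hq hr
  exact ⟨b, hb, hd.trans hκ⟩

theorem ThinWalks.thin (hc : X.Connected) {κ : ℕ} (h : X.ThinWalks κ) {x p y : V} (z : V)
    (hp : X.Btw x p y) : ∃ b, (X.Btw y b z ∨ X.Btw x b z) ∧ X.dist p b ≤ κ := by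
  obtain ⟨q, hq⟩ := exists_geodesicWalk hc y z
  obtain ⟨r, hr⟩ := exists_geodesicWalk hc x z
  obtain ⟨b, hb, hd⟩ := h x p y z q r hp hq hr
  exact ⟨b, hb.imp (fun h => hq.btw hc h) (fun h => hr.btw hc h), hd⟩

/-- A point on the side `[x, y]` of a triangle that is close to the two other sides. -/
theorem ThinWalks.exists_center (hc : X.Connected) {κ : ℕ} (h : X.ThinWalks κ) (x y z : V) :
    ∃ p, X.Btw x p y ∧ X.dist x p + X.dist p z ≤ X.dist x z + 2 * κ + 2 ∧
      X.dist y p + X.dist p z ≤ X.dist y z + 2 * κ + 2 := by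
  classical
  obtain ⟨w, hw⟩ := exists_geodesicWalk hc x y
  have hb : ∀ i, X.Btw x (w.getVert i) y := fun i => hw.btw hc (w.getVert_mem_support i)
  have hex : ∃ i, X.dist y (w.getVert i) + X.dist (w.getVert i) z ≤ X.dist y z + 2 * κ :=
    ⟨w.length, by simp⟩
  -- The first vertex of the geodesic that is close to `[y, z]`; its predecessor is not, so thinness
  -- puts it near `[x, z]`.
  set i := Nat.find hex with hi
  have h1 := Nat.find_spec hex
  rw [← hi] at h1
  refine ⟨w.getVert i, hb i, ?_, by omega⟩
  rcases Nat.eq_zero_or_pos i with h0 | h0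
  · rw [h0]; simp; omega
  · have h2 := Nat.find_min hex (m := i - 1) (by omega)
    obtain ⟨b, hb', hd⟩ := h.thin hc z (hb (i - 1))
    have hle : ¬ (w.length ≤ i - 1) := fun hle => h2 (by
      rw [Walk.getVert_of_length_le _ hle]; simp)
    have hadj := w.adj_getVert_succ (i := i - 1) (by omega)
    rw [show i - 1 + 1 = i by omega] at hadj
    have hadj' := dist_eq_one_iff_adj.2 hadj
    have t1 := hc.dist_triangle (u := y) (v := b) (w := w.getVert (i - 1))
    have t2 := hc.dist_triangle (u := w.getVert (i - 1)) (v := b) (w := z)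
    have t3 := hc.dist_triangle (u := x) (v := b) (w := w.getVert (i - 1))
    have t4 := hc.dist_triangle (u := x) (v := w.getVert (i - 1)) (w := w.getVert i)
    have t5 := hc.dist_triangle (u := w.getVert i) (v := w.getVert (i - 1)) (w := z)
    have c1 := X.dist_comm (u := b) (v := w.getVert (i - 1))
    have c2 := X.dist_comm (u := w.getVert i) (v := w.getVert (i - 1))
    unfold Btw at hb'
    rcases hb' with hb' | hb'
    · exact absurd (by omega) h2
    · omega

/-- The center `p` of the triangle `x, y, z` is almost on all three sides. Thinness with respect to
`w` puts it near `[y, w]` or `[x, w]`, which gives the two alternatives. -/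
theorem ThinWalks.fourPoint (hc : X.Connected) {κ : ℕ} (h : X.ThinWalks κ) :
    X.FourPoint (4 * κ + 2) := by
  intro x y z w
  obtain ⟨p, hp, h1, h2⟩ := h.exists_center hc x y z
  obtain ⟨b, hb, hd⟩ := h.thin hc w hp
  have t1 := hc.dist_triangle (u := y) (v := b) (w := p)
  have t2 := hc.dist_triangle (u := x) (v := b) (w := p)
  have t3 := hc.dist_triangle (u := p) (v := b) (w := w)
  have t4 := hc.dist_triangle (u := z) (v := p) (w := w)
  have c1 := X.dist_comm (u := b) (v := p)
  have c2 := X.dist_comm (u := z) (v := p)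
  have c3 := X.dist_comm (u := y) (v := p)
  unfold Btw at hp hb
  rcases hb with hb | hb
  · left; omega
  · right; omega

end Hyperbolic

end SimpleGraph

/-! ### Short simple loops through an edge -/

namespace SimpleGraph

/-- The vertices of the simple loops of length at most `L` through `e`. -/
def loopVerts {V : Type*} (X : SimpleGraph V) (e : Sym2 V) (L : ℕ) : Set V :=
  {v | ∃ C ∈ X.simpleLoopsThrough e L, v ∈ C.verts}

/-- The edge `e` lies on boundedly many vertices of short simple loops. -/
def FineBound {V : Type*} (X : SimpleGraph V) (M : ℕ → ℕ) : Prop :=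
  ∀ e ∈ X.edgeSet, ∀ L : ℕ, ∃ N : Finset V, N.card ≤ M L ∧ ∀ v ∈ X.loopVerts e L, v ∈ N

section Fine

variable {V : Type*} {X : SimpleGraph V}

theorem IsUniformlyFine.exists_fineBound (h : X.IsUniformlyFine) : ∃ M, X.FineBound M := by
  classical
  obtain ⟨φ, hφ⟩ := h
  refine ⟨fun L => φ L * (L + 1), fun e he L => ?_⟩
  have hfin : (X.simpleLoopsThrough e L).Finite :=
    Set.finite_of_encard_le_coe (hφ e he L)
  have hcard : hfin.toFinset.card ≤ φ L := by
    have := hφ e he L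
    rw [hfin.encard_eq_coe_toFinset_card] at this
    exact_mod_cast this
  have hC : ∀ C : X.Subgraph, ∃ N : Finset V, C ∈ X.simpleLoopsThrough e L →
      N.card ≤ L + 1 ∧ ∀ v ∈ C.verts, v ∈ N := by
    intro C
    by_cases hC : C ∈ X.simpleLoopsThrough e L
    · obtain ⟨v, p, -, hp, -, rfl⟩ := hC
      refine ⟨p.support.toFinset, fun _ => ⟨?_, fun v hv => ?_⟩⟩
      · refine (List.toFinset_card_le _).trans ?_
        rw [Walk.length_support]
        omega
      · simpa using hv
    · exact ⟨∅, fun h => absurd h hC⟩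
  choose N hN using hC
  refine ⟨hfin.toFinset.biUnion N, ?_, ?_⟩
  · calc _ ≤ hfin.toFinset.card * (L + 1) :=
          Finset.card_biUnion_le_card_mul _ _ _ fun C hC => (hN C (by simpa using hC)).1
      _ ≤ _ := Nat.mul_le_mul_right _ hcard
  · rintro v ⟨C, hC, hv⟩
    exact Finset.mem_biUnion.2 ⟨C, by simpa using hC, (hN C hC).2 v hv⟩

theorem dist_le_of_mem_loopVerts (hc : X.Connected) {a b v : V} {L : ℕ}
    (hv : v ∈ X.loopVerts s(a, b) L) : X.dist v b ≤ 2 * L := by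
  classical
  obtain ⟨C, ⟨z, p, -, hp, he, rfl⟩, hv⟩ := hv
  have hv' : v ∈ p.support := by simpa using hv
  have hb : b ∈ p.support := p.snd_mem_support_of_mem_edges he
  have h1 := dist_le (p.takeUntil v hv')
  have h2 := dist_le (p.takeUntil b hb)
  have h3 := p.length_takeUntil_le_length hv'
  have h4 := p.length_takeUntil_le_length hb
  have h5 := hc.dist_triangle (u := v) (v := z) (w := b)
  have h6 := X.dist_comm (u := v) (v := z)
  omega

/-- A closed walk through an edge `ab` that is made of three pieces, the first and the last of which
meet in the middle piece only, contains a simple loop through `ab` that meets the middle piece. -/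
theorem exists_mem_loopVerts {a b c d : V} {L : ℕ} (hab : X.Adj a b) (w₁ : X.Walk b c)
    (w₂ : X.Walk c d) (w₃ : X.Walk d a) (h₁ : a ∉ w₁.support) (h₃ : b ∉ w₃.support)
    (h₂ : s(a, b) ∉ w₂.edges) (hi : ∀ v ∈ w₁.support, v ∈ w₃.support → v ∈ w₂.support)
    (hL : w₁.length + w₂.length + w₃.length + 1 ≤ L) :
    ∃ v ∈ w₂.support, v ∈ X.loopVerts s(a, b) L := by
  classical
  set w := (w₁.append w₂).append w₃ with hw
  have hew : s(a, b) ∉ w.edges := by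
    simp only [hw, Walk.edges_append, List.mem_append, not_or]
    exact ⟨⟨fun h => h₁ (Walk.fst_mem_support_of_mem_edges _ h), h₂⟩,
      fun h => h₃ (Walk.snd_mem_support_of_mem_edges _ h)⟩
  have hcyc : (Walk.cons hab w.bypass).IsCycle :=
    (Walk.cons_isCycle_iff _ _).2
      ⟨w.bypass_isPath, fun h => hew (w.edges_bypass_subset_edges h)⟩
  have hlen : (Walk.cons hab w.bypass).length ≤ L := by
    have := w.length_bypass_le_length
    rw [Walk.length_cons]
    simp only [hw, Walk.length_append] at this
    simp only [hw] at *
    omega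
  have hmem : ∀ v ∈ w.bypass.support, v ∈ X.loopVerts s(a, b) L := fun v hv =>
    ⟨_, ⟨a, Walk.cons hab w.bypass, hcyc, hlen, by simp, rfl⟩, by
      rw [Walk.mem_verts_toSubgraph, Walk.support_cons]
      exact List.mem_cons_of_mem _ hv⟩
  by_contra! hno
  have hav : ∀ v ∈ w.bypass.support, v ∉ w₂.support := fun v hv h => hno v h (hmem v hv)
  -- A part of `w` that avoids `w₂` cannot leave `w₁`: passing to an edge of `w₃` needs a vertex
  -- common to `w₁` and `w₃`, which is on `w₂`. So the bypass would reach `a` inside `w₁`.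
  have key : ∀ {x y : V} (r : X.Walk x y), r.edges ⊆ w.edges →
      (∀ v ∈ r.support, v ∉ w₂.support) → x ∈ w₁.support → y ∈ w₁.support := by
    intro x y r
    induction r with
    | nil => exact fun _ _ h => h
    | @cons x z y hxz r ih =>
      intro hr hs hx
      have hz : z ∈ (Walk.cons hxz r).support := by simp
      refine ih (fun e he => hr (by simp [he])) (fun v hv => hs v (by simp [hv])) ?_
      have he : s(x, z) ∈ w.edges := hr (by simp)
      simp only [hw, Walk.edges_append, List.mem_append] at he
      rcases he with (he | he) | he
      · exact Walk.snd_mem_support_of_mem_edges _ he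
      · exact absurd (Walk.snd_mem_support_of_mem_edges _ he) (hs z hz)
      · exact absurd (hi x hx (Walk.fst_mem_support_of_mem_edges _ he)) (hs x (by simp))
  have ha := key w.bypass (w.edges_bypass_subset_edges) hav w₁.start_mem_support
  exact h₁ ha

/-- The walk closes up with the two edges at `p`. Thus for a given edge `pc` only boundedly many
edges `pb` make a small angle with it at `p`. -/
theorem mem_loopVerts_of_walk {p b c : V} {L : ℕ} (hb : X.Adj p b) (hcp : X.Adj p c) (hne : b ≠ c)
    (w : X.Walk b c) (hp : p ∉ w.support) (hL : w.length + 2 ≤ L) :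
    b ∈ X.loopVerts s(p, c) L := by
  classical
  have hp' : p ∉ w.bypass.support := fun h => hp (w.support_bypass_subset_support h)
  set r := w.bypass.concat hcp.symm with hr
  have hpath : r.IsPath := w.bypass_isPath.concat hp' hcp.symm
  have he : s(p, b) ∉ r.edges := by
    rw [hr, Walk.edges_concat]
    simp only [List.concat_eq_append, List.mem_append, List.mem_singleton, not_or]
    refine ⟨fun h => hp' (Walk.fst_mem_support_of_mem_edges _ h), fun h => ?_⟩
    rw [Sym2.eq_swap, Sym2.congr_left] at h
    exact hne h
  refine ⟨_, ⟨p, Walk.cons hb r, (Walk.cons_isCycle_iff _ _).2 ⟨hpath, he⟩, ?_, ?_, rfl⟩, ?_⟩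
  · have := w.length_bypass_le_length
    rw [Walk.length_cons, hr, Walk.length_concat]
    omega
  · rw [Walk.edges_cons, hr, Walk.edges_concat, Sym2.eq_swap]
    simp
  · simp

end Fine

end SimpleGraph

/-! ### Geodesics crossing short loops, and angles -/

namespace SimpleGraph

section Crossing

variable {V : Type*} {X : SimpleGraph V}

/-- Beyond its first vertex, a geodesic through the edge `ab` stays close to, and hence can be
joined to, a geodesic towards the same endpoint. -/
theorem ThinWalks.exists_walk_beyond (hc : X.Connected) {κ : ℕ} (hT : X.ThinWalks κ)
    {x b y u : V} (hb : X.Btw x b y) (hu : X.dist x u ≤ X.dist x b) {γ : X.Walk u y}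
    (hγ : IsGeodesicWalk γ) :
    ∃ w ∈ γ.support, ∃ r : X.Walk b w, r.length ≤ 2 * κ + 1 ∧
      ∀ v ∈ r.support, X.dist x b < X.dist x v ∨ v = b := by
  have hlev : ∀ v, X.Btw b v y → X.dist x b < X.dist x v ∨ v = b := by
    intro v hv
    have h1 := hb.trans_mid' hc hv
    by_cases h : v = b
    · exact Or.inr h
    · have := hc.pos_dist_of_ne (Ne.symm h)
      unfold Btw at h1
      left; omega
  by_cases hd : X.dist b y ≤ κ + 1
  · obtain ⟨r, hr, hr'⟩ := exists_walk_btw hc b y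
    exact ⟨y, γ.end_mem_support, r, by omega, fun v hv => hlev v (hr' v hv)⟩
  -- At height `κ + 1` above `b`, the vertex `z` is not `κ`-close to `[x, u]`, which stays in the
  -- ball of radius `d(x, b)`; so it is close to `γ`.
  · obtain ⟨z, hz, hz'⟩ := exists_btw_dist_eq hc (x := b) (y := y) (n := κ + 1) (by omega)
    obtain ⟨s, hs⟩ := exists_geodesicWalk hc x u
    have hxbz := hb.trans_mid' hc hz
    obtain ⟨w, hw, hzw⟩ := hT x z y u γ.reverse s (hb.trans_right hc hz)
      (by unfold IsGeodesicWalk at *; rw [Walk.length_reverse, hγ, dist_comm]) hs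
    have t1 := hc.dist_triangle (u := x) (v := w) (w := z)
    have c1 := X.dist_comm (u := w) (v := z)
    have hwγ : w ∈ γ.support := by
      rcases hw with hw | hw
      · simpa using hw
      · have := hs.btw hc hw
        unfold Btw at this hxbz
        omega
    obtain ⟨r₁, hr₁, hr₁'⟩ := exists_walk_btw hc b z
    obtain ⟨r₂, hr₂, hr₂'⟩ := exists_walk_btw hc z w
    refine ⟨w, hwγ, r₁.append r₂, by rw [Walk.length_append]; omega, fun v hv => ?_⟩
    rcases (Walk.mem_support_append_iff _ _).1 hv with hv | hv
    · exact hlev v (hz.trans_left hc (hr₁' v hv))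
    · have h1 := hr₂' v hv
      have t2 := hc.dist_triangle (u := x) (v := v) (w := z)
      have c2 := X.dist_comm (u := v) (v := z)
      unfold Btw at h1 hxbz
      left; omega

/-- Counterpart of `ThinWalks.exists_walk_beyond` on the near side of the edge. This connection
stays in the ball of radius `d(x, a)`, so the two are separated by their distance to `x`. The
exception `v = u` is there because `u` may be as far from `x` as `b`. -/
theorem ThinWalks.exists_walk_before (hc : X.Connected) {κ : ℕ} (hT : X.ThinWalks κ)
    {x a y u : V} (ha : X.Btw x a y) (hu : X.dist x u ≤ X.dist x a + 1) {γ : X.Walk u y}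
    (hγ : IsGeodesicWalk γ) :
    ∃ w ∈ γ.support, ∃ r : X.Walk w a, r.length ≤ 4 * κ + 3 ∧
      ∀ v ∈ r.support, X.dist x v ≤ X.dist x a ∨ v = u := by
  have hlev : ∀ v, X.Btw x v u → X.dist x v ≤ X.dist x a ∨ v = u := by
    intro v hv
    by_cases h : v = u
    · exact Or.inr h
    · have := hc.pos_dist_of_ne h
      unfold Btw at hv
      left; omega
  have hlev' : ∀ v, X.Btw x v a → X.dist x v ≤ X.dist x a := by
    intro v hv
    unfold Btw at hv
    omega
  by_cases hd : X.dist x a ≤ κ + 1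
  · obtain ⟨r₁, hr₁, hr₁'⟩ := exists_walk_btw hc u x
    obtain ⟨r₂, hr₂, hr₂'⟩ := exists_walk_btw hc x a
    refine ⟨u, γ.start_mem_support, r₁.append r₂, ?_, fun v hv => ?_⟩
    · rw [Walk.length_append, hr₁, hr₂, X.dist_comm (u := u)]; omega
    · rcases (Walk.mem_support_append_iff _ _).1 hv with hv | hv
      · exact hlev v (hr₁' v hv).symm
      · exact Or.inl (hlev' v (hr₂' v hv))
  · obtain ⟨c, hcb, hcd⟩ := exists_btw_dist_eq hc (x := x) (y := a)
      (n := X.dist x a - (κ + 1)) (by omega)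
    have hca : X.dist c a = κ + 1 := by unfold Btw at hcb; omega
    obtain ⟨s, hs⟩ := exists_geodesicWalk hc x u
    obtain ⟨w, hw, hcw⟩ := hT x c y u γ.reverse s (ha.trans_left hc hcb)
      (by unfold IsGeodesicWalk at *; rw [Walk.length_reverse, hγ, dist_comm]) hs
    obtain ⟨r₁, hr₁, hr₁'⟩ := exists_walk_btw hc w c
    obtain ⟨r₂, hr₂, hr₂'⟩ := exists_walk_btw hc c a
    have c1 := X.dist_comm (u := w) (v := c)
    have hr : ∀ v ∈ (r₁.append r₂).support, X.dist x v ≤ X.dist x a := by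
      intro v hv
      rcases (Walk.mem_support_append_iff _ _).1 hv with hv | hv
      · have h1 := hr₁' v hv
        have t2 := hc.dist_triangle (u := x) (v := c) (w := v)
        have c2 := X.dist_comm (u := v) (v := c)
        unfold Btw at h1
        omega
      · exact hlev' v (hcb.symm.trans_left hc (hr₂' v hv).symm).symm
    rcases hw with hw | hw
    · refine ⟨w, by simpa using hw, r₁.append r₂, ?_, fun v hv => Or.inl (hr v hv)⟩
      rw [Walk.length_append]; omega
    · have hxwu := hs.btw hc hw
      obtain ⟨r₀, hr₀, hr₀'⟩ := exists_walk_btw hc u w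
      refine ⟨u, γ.start_mem_support, r₀.append (r₁.append r₂), ?_, fun v hv => ?_⟩
      · have t1 := hc.dist_triangle (u := x) (v := w) (w := c)
        have c3 := X.dist_comm (u := u) (v := w)
        rw [Walk.length_append, Walk.length_append]
        unfold Btw at hxwu
        omega
      · rcases (Walk.mem_support_append_iff _ _).1 hv with hv | hv
        · exact hlev v (hxwu.symm.trans_left hc (hr₀' v hv)).symm
        · exact Or.inl (hr v hv)

/-- If an edge `ab` lies on a geodesic from `x` to `y` and `u` is not farther from `x` than the edge,
then a geodesic from `u` to `y` crosses a short simple loop through the edge. -/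
theorem ThinWalks.exists_btw_mem_loopVerts (hc : X.Connected) {κ : ℕ} (hT : X.ThinWalks κ)
    {x a b y u : V} (hab : X.Adj a b) (hxa : X.dist x a + 1 = X.dist x b) (hb : X.Btw x b y)
    (hu : X.dist x u ≤ X.dist x b) :
    ∃ v, X.Btw u v y ∧ (v = a ∨ v = b ∨ v ∈ X.loopVerts s(a, b) (12 * κ + 10)) := by
  obtain ⟨γ, hγ⟩ := exists_geodesicWalk hc u y
  by_cases haγ : a ∈ γ.support
  · exact ⟨a, hγ.btw hc haγ, Or.inl rfl⟩
  by_cases hbγ : b ∈ γ.support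
  · exact ⟨b, hγ.btw hc hbγ, Or.inr (Or.inl rfl)⟩
  have hxab : X.Btw x a b := by
    unfold Btw
    rw [dist_eq_one_iff_adj.2 hab, hxa]
  obtain ⟨w, hw, r₁, hl₁, hr₁⟩ := hT.exists_walk_beyond hc hb hu hγ
  obtain ⟨w', hw', r₃, hl₃, hr₃⟩ := hT.exists_walk_before hc (hb.trans_left hc hxab)
    (by omega) hγ
  obtain ⟨r₂, hl₂, hr₂⟩ := hγ.exists_subwalk hw hw'
  -- The piece of `γ` between the two junctions is at most as long as the way through the edge, `(2κ
  -- + 1) + 1 + (4κ + 3)`. This makes a closed walk of length at most `12κ + 10`.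
  have hlen := dist_le ((r₁.reverse.concat hab.symm).append r₃.reverse)
  simp only [Walk.length_append, Walk.length_concat, Walk.length_reverse] at hlen
  obtain ⟨v, hv, hv'⟩ := exists_mem_loopVerts (L := 12 * κ + 10) hab r₁ r₂ r₃
    (fun h => by
      rcases hr₁ _ h with h | h
      · omega
      · exact hab.ne h)
    (fun h => by
      rcases hr₃ _ h with h | h
      · omega
      · exact hbγ (h ▸ γ.start_mem_support))
    (fun h => haγ (hr₂ _ (Walk.fst_mem_support_of_mem_edges _ h)))
    (fun v h h' => by
      rcases hr₃ _ h' with h' | h'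
      · rcases hr₁ _ h with h | h
        · omega
        · rw [h] at h'; omega
      · rcases hr₁ _ h with h | h
        · rw [h'] at h; omega
        · exact absurd (h ▸ h' ▸ γ.start_mem_support) hbγ)
    (by omega)
  exact ⟨v, hγ.btw hc (hr₂ v hv), Or.inr (Or.inr hv')⟩

/-- Geodesics fellow travel up to the Gromov product of their endpoints: one four-point inequality
puts `p` almost on `[x, y]`, the other compares it there with `q`, and each costs `κ`. -/
theorem FourPoint.dist_le_of_btw {κ : ℕ} (hF : X.FourPoint κ) {x y z p q : V}
    (hp : X.Btw x p z) (hq : X.Btw x q y) (hpq : X.dist x p = X.dist x q)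
    (h : X.dist z y + 2 * X.dist x p ≤ X.dist x z + X.dist x y) : X.dist p q ≤ 2 * κ := by
  have h1 := hF x z p y
  have h2 := hF x y p q
  have c1 := X.dist_comm (u := z) (v := p)
  have c2 := X.dist_comm (u := y) (v := q)
  have c3 := X.dist_comm (u := y) (v := p)
  unfold Btw at *
  omega

/-- While two geodesics from `x` fellow travel, a vertex of the one lies on a short simple loop
through any parallel edge of the other. -/
theorem FourPoint.mem_loopVerts_of_btw (hc : X.Connected) {κ : ℕ} (hF : X.FourPoint κ)
    {x y z a b b' : V} (hab : X.Adj a b) (hxa : X.dist x a + 1 = X.dist x b) (hb : X.Btw x b z)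
    (hb' : X.Btw x b' y) (hbb' : X.dist x b' = X.dist x b)
    (h : X.dist z y + 2 * (X.dist x b + (2 * κ + 1)) ≤ X.dist x z + X.dist x y) :
    b' = b ∨ b' ∈ X.loopVerts s(a, b) (12 * κ + 5) := by
  by_cases hne : b' = b
  · exact Or.inl hne
  right
  have tz := hc.dist_triangle (u := x) (v := y) (w := z)
  have ty := hc.dist_triangle (u := x) (v := z) (w := y)
  have czy := X.dist_comm (u := y) (v := z)
  have hbz : 2 * κ + 1 ≤ X.dist b z := by unfold Btw at hb; omega
  have hby : 2 * κ + 1 ≤ X.dist b' y := by unfold Btw at hb'; omega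
  -- The two geodesics are joined by segments of length at most `2κ` at distance `2κ + 1` above and
  -- below the level of `b`. These are too short to return to that level, so the upper and lower
  -- halves of the closed walk share only `b'`, and the simple loop must pass through it.
  obtain ⟨z₁, hz₁, hdz⟩ := exists_btw_dist_eq hc hbz
  obtain ⟨y₁, hy₁, hdy⟩ := exists_btw_dist_eq hc hby
  have hxz := hb.trans_mid' hc hz₁
  have hxy := hb'.trans_mid' hc hy₁
  have hzy : X.dist z₁ y₁ ≤ 2 * κ := by
    refine hF.dist_le_of_btw (hb.trans_right hc hz₁) (hb'.trans_right hc hy₁) ?_ ?_ <;>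
    · unfold Btw at hxz hxy
      omega
  have hxab : X.Btw x a b := by
    unfold Btw
    rw [dist_eq_one_iff_adj.2 hab, hxa]
  obtain ⟨x₁, hx₁, hdx⟩ := exists_btw_dist_eq hc (x := x) (y := b')
    (n := X.dist x b' - (2 * κ + 1)) (by omega)
  obtain ⟨a₁, ha₁, hda⟩ := exists_btw_dist_eq hc (x := x) (y := a)
    (n := X.dist x b' - (2 * κ + 1)) (by omega)
  have hxa₁ : X.dist a₁ x₁ ≤ 2 * κ :=
    hF.dist_le_of_btw ((hb.trans_left hc hxab).trans_left hc ha₁) (hb'.trans_left hc hx₁)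
      (by omega) (by omega)
  -- Near `x` the subtraction truncates; both lower corners are then `x` itself.
  have hxa₂ : X.dist x b' ≤ 2 * κ + 1 → X.dist a₁ x₁ = 0 := by
    intro h0
    have e1 := hc.dist_eq_zero_iff.1 (show X.dist x a₁ = 0 by omega)
    have e2 := hc.dist_eq_zero_iff.1 (show X.dist x x₁ = 0 by omega)
    rw [← e1, ← e2, dist_self]
  obtain ⟨r₁, hl₁, hr₁⟩ := exists_walk_btw hc b z₁
  obtain ⟨r₂, hl₂, hr₂⟩ := exists_walk_btw hc z₁ y₁
  obtain ⟨r₃, hl₃, hr₃⟩ := exists_walk_btw hc y₁ b'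
  obtain ⟨r₄, hl₄, hr₄⟩ := exists_walk_btw hc b' x₁
  obtain ⟨r₅, hl₅, hr₅⟩ := exists_walk_btw hc x₁ a₁
  obtain ⟨r₆, hl₆, hr₆⟩ := exists_walk_btw hc a₁ a
  have c1 := X.dist_comm (u := y₁) (v := b')
  have c2 := X.dist_comm (u := b') (v := x₁)
  have c3 := X.dist_comm (u := x₁) (v := a₁)
  have hup : ∀ v ∈ ((r₁.append r₂).append r₃).support, X.dist x b ≤ X.dist x v := by
    intro v hv
    simp only [Walk.mem_support_append_iff] at hv
    rcases hv with (hv | hv) | hv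
    · have := hxz.trans_mid' hc (hr₁ v hv)
      unfold Btw at this
      omega
    · have := hr₂ v hv
      have t := hc.dist_triangle (u := x) (v := v) (w := z₁)
      have c := X.dist_comm (u := v) (v := z₁)
      unfold Btw at this hxz
      omega
    · have := hxy.trans_mid' hc (hr₃ v hv).symm
      unfold Btw at this
      omega
  have hdown : ∀ v ∈ ((r₄.append r₅).append r₆).support, X.dist x v < X.dist x b ∨ v = b' := by
    intro v hv
    simp only [Walk.mem_support_append_iff] at hv
    rcases hv with (hv | hv) | hv
    · have := hx₁.symm.trans_left hc (hr₄ v hv)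
      by_cases hvb : v = b'
      · exact Or.inr hvb
      · have hpos := hc.pos_dist_of_ne hvb
        have := this.symm
        unfold Btw at this
        left; omega
    · have := hr₅ v hv
      have t := hc.dist_triangle (u := x) (v := x₁) (w := v)
      unfold Btw at this
      left; omega
    · have := (ha₁.symm.trans_left hc (hr₆ v hv).symm).symm
      unfold Btw at this
      left; omega
  obtain ⟨v, hv, hv'⟩ := exists_mem_loopVerts (L := 12 * κ + 5) hab ((r₁.append r₂).append r₃)
    (Walk.nil : X.Walk b' b') ((r₄.append r₅).append r₆)
    (fun h => by have := hup _ h; omega)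
    (fun h => by
      rcases hdown _ h with h | h
      · omega
      · exact hne h.symm)
    (by simp)
    (fun v h h' => by
      have := hup _ h
      rcases hdown _ h' with h' | h'
      · omega
      · simp [h'])
    (by
      have e1 : X.dist x₁ b' ≤ 2 * κ + 1 := by unfold Btw at hx₁; omega
      have e2 : X.dist a₁ a ≤ 2 * κ + 1 := by unfold Btw at ha₁; omega
      simp only [Walk.length_append, Walk.length_nil]
      omega)
  simp only [Walk.support_nil, List.mem_singleton] at hv
  exact hv ▸ hv'

theorem Btw.ne_of_adj {p a y v : V} (hpa : X.Adj p a) (h : X.Btw p a y) (hv : X.Btw a v y) :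
    v ≠ p := by
  rintro rfl
  have h1 := dist_eq_one_iff_adj.2 hpa
  have h2 := X.dist_comm (u := v) (v := a)
  unfold Btw at *
  omega

/-- The vertex `z` of `[p, y]` at distance `κ + 1` from `p` is `κ`-close to one of the other sides
of the triangle `p, y, u`, by a connection too short to meet `p`. It ends on `γ` or on `[p, u]`, and
in the latter case the walk goes on to `c`. -/
theorem ThinWalks.exists_walk_avoiding_aux (hc : X.Connected) {κ : ℕ} (hT : X.ThinWalks κ)
    {p u y c b : V} (hpc : X.Adj p c) (hc' : X.Btw p c u) (hpb : X.Adj p b) (hb : X.Btw p b y)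
    {γ : X.Walk y u} (hγ : IsGeodesicWalk γ) :
    (∃ w ∈ γ.support, ∃ r : X.Walk b w, p ∉ r.support ∧ r.length ≤ 4 * κ + 4) ∨
      ∃ r : X.Walk b c, p ∉ r.support ∧ r.length ≤ 4 * κ + 4 := by
  have hpb1 := dist_eq_one_iff_adj.2 hpb
  have hpc1 := dist_eq_one_iff_adj.2 hpc
  by_cases hd : X.dist b y ≤ κ
  · obtain ⟨r, hl, hr⟩ := exists_walk_btw hc b y
    exact Or.inl ⟨y, γ.start_mem_support, r, fun h => hb.ne_of_adj hpb (hr p h) rfl, by omega⟩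
  · obtain ⟨z, hz, hdz⟩ := exists_btw_dist_eq hc (x := b) (y := y) (n := κ) (by omega)
    obtain ⟨s, hs⟩ := exists_geodesicWalk hc c u
    have hpz : X.dist p z = κ + 1 := by
      have := hb.trans_mid' hc hz
      unfold Btw at this
      omega
    obtain ⟨w, hw, hzw⟩ := hT p z y u γ (Walk.cons hpc s) (hb.trans_right hc hz) hγ
      (by unfold IsGeodesicWalk at *; unfold Btw at hc'; rw [Walk.length_cons]; omega)
    have cz := X.dist_comm (u := z) (v := p)
    obtain ⟨r₁, hl₁, hr₁⟩ := exists_walk_btw hc b z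
    obtain ⟨r₂, hl₂, hr₂⟩ := exists_walk_btw hc z w
    have hp₁ : p ∉ r₁.support := fun h => hb.ne_of_adj hpb (hz.trans_left hc (hr₁ p h)) rfl
    have hp₂ : p ∉ r₂.support := fun h => by
      have := hr₂ p h
      unfold Btw at this
      omega
    have hp₁₂ : p ∉ (r₁.append r₂).support := by
      rw [Walk.mem_support_append_iff]; tauto
    rcases hw with hw | hw
    · exact Or.inl ⟨w, hw, r₁.append r₂, hp₁₂, by rw [Walk.length_append]; omega⟩
    · have hwp : w ≠ p := by
        rintro rfl
        omega
      have hws : w ∈ s.support := by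
        rw [Walk.support_cons, List.mem_cons] at hw
        exact hw.resolve_left hwp
      have hws := hs.btw hc hws
      obtain ⟨r₃, hl₃, hr₃⟩ := exists_walk_btw hc w c
      have hp₃ : p ∉ r₃.support := fun h =>
        hc'.ne_of_adj hpc (hws.trans_left hc (hr₃ p h).symm) rfl
      refine Or.inr ⟨(r₁.append r₂).append r₃, by rw [Walk.mem_support_append_iff]; tauto, ?_⟩
      have hl := dist_le ((((r₁.append r₂).reverse.concat hpb.symm).concat hpc))
      simp only [Walk.length_append, Walk.length_concat, Walk.length_reverse] at hl ⊢
      omega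

/-- If no geodesic from `u` to `y` passes through `p`, then the first steps of geodesics from `p` to
`u` and to `y` span a small angle at `p`. -/
theorem ThinWalks.exists_walk_avoiding (hc : X.Connected) {κ : ℕ} (hT : X.ThinWalks κ)
    {p u y c b : V} (hpc : X.Adj p c) (hc' : X.Btw p c u) (hpb : X.Adj p b) (hb : X.Btw p b y)
    (hp : ¬ X.Btw u p y) :
    ∃ r : X.Walk b c, p ∉ r.support ∧ r.length ≤ 16 * κ + 18 := by
  obtain ⟨γ, hγ⟩ := exists_geodesicWalk hc y u
  have hγ' : IsGeodesicWalk γ.reverse := by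
    unfold IsGeodesicWalk at *
    rw [Walk.length_reverse, hγ, dist_comm]
  have hpγ : p ∉ γ.support := fun h => hp (hγ.btw hc h).symm
  rcases hT.exists_walk_avoiding_aux hc hpc hc' hpb hb hγ with ⟨w, hw, r, hr, hl⟩ | ⟨r, hr, hl⟩
  · rcases hT.exists_walk_avoiding_aux hc hpb hb hpc hc' hγ' with
      ⟨w', hw', r', hr', hl'⟩ | ⟨r', hr', hl'⟩
    -- Both first steps are joined to `γ`, which avoids `p`. The piece of `γ` between the junctions
    -- has length at most `2(4κ + 4) + 2`.
    · obtain ⟨s, hs, hs'⟩ := hγ.exists_subwalk hw (by simpa using hw')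
      have hlen := dist_le (((r.reverse.concat hpb.symm).concat hpc).append r')
      refine ⟨(r.append s).append r'.reverse, ?_, ?_⟩
      · have : p ∉ s.support := fun h => hpγ (hs' p h)
        simp only [Walk.mem_support_append_iff, Walk.support_reverse, List.mem_reverse]
        tauto
      · simp only [Walk.length_append, Walk.length_concat, Walk.length_reverse] at hlen ⊢
        omega
    · exact ⟨r'.reverse, by simpa using hr', by rw [Walk.length_reverse]; omega⟩
  · exact ⟨r, hr, by omega⟩

end Crossing

end SimpleGraph

theorem exists_finset_representatives {α β : Type*} (P : α → Prop) (f : α → β) (T : Finset β)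
    (h : ∀ a, P a → f a ∈ T) :
    ∃ B : Finset α, B.card ≤ T.card ∧ (∀ a ∈ B, P a) ∧ ∀ a, P a → ∃ a' ∈ B, f a' = f a := by
  classical
  have hg : ∀ t : {t // t ∈ T.filter fun t => ∃ a, P a ∧ f a = t}, ∃ a, P a ∧ f a = t.1 :=
    fun t => (Finset.mem_filter.1 t.2).2
  choose g hg using hg
  refine ⟨Finset.univ.image g, ?_, ?_, ?_⟩
  · refine Finset.card_image_le.trans ?_
    rw [Finset.card_univ, Fintype.card_coe]
    exact Finset.card_filter_le _ _
  · intro a ha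
    obtain ⟨t, -, rfl⟩ := Finset.mem_image.1 ha
    exact (hg t).1
  · intro a ha
    exact ⟨_, Finset.mem_image_of_mem g
      (Finset.mem_univ ⟨f a, Finset.mem_filter.2 ⟨h a ha, a, ha, rfl⟩⟩), (hg _).2⟩

/-! ### Cones, and finiteness statements for them -/

namespace SimpleGraph

/-- The vertices `y'` for which `d(·, y')` and `d(·, y)` differ by a constant on the ball of radius
`n` around `x`. -/
def cone {V : Type*} (X : SimpleGraph V) (x : V) (n : ℕ) (y : V) : Set V :=
  {y' | ∀ u, X.dist x u ≤ n → X.dist u y' + X.dist x y = X.dist u y + X.dist x y'}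

section Cone

variable {V : Type*} {X : SimpleGraph V}

theorem mem_cone_self (x : V) (n : ℕ) (y : V) : y ∈ X.cone x n y := fun _ _ => rfl

theorem mem_cone_symm {x y y' : V} {n : ℕ} (h : y' ∈ X.cone x n y) : y ∈ X.cone x n y' :=
  fun u hu => (h u hu).symm

theorem cone_eq_of_mem {x y y' : V} {n : ℕ} (h : y' ∈ X.cone x n y) :
    X.cone x n y' = X.cone x n y := by
  ext z
  constructor <;> intro hz u hu
  · have h1 := h u hu
    have h2 := hz u hu
    omega
  · have h1 := h u hu
    have h2 := hz u hu
    omega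

theorem cone_anti {x y : V} {m n : ℕ} (h : m ≤ n) : X.cone x n y ⊆ X.cone x m y :=
  fun _ hy u hu => hy u (hu.trans h)

theorem cone_zero (hc : X.Connected) (x y : V) : X.cone x 0 y = Set.univ := by
  refine Set.eq_univ_of_forall fun y' u hu => ?_
  obtain rfl := hc.dist_eq_zero_iff.1 (Nat.le_zero.1 hu)
  omega

theorem cone_subset_of_mem {x y z w : V} {m n : ℕ} (h : m ≤ n) (hw : w ∈ X.cone x n y)
    (hw' : w ∈ X.cone x m z) : X.cone x n y ⊆ X.cone x m z := by
  rw [← cone_eq_of_mem hw, ← cone_eq_of_mem hw']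
  exact cone_anti h

theorem Btw.of_mem_cone {x p y y' : V} {n : ℕ} (h : X.Btw x p y) (hp : X.dist x p ≤ n)
    (hy : y' ∈ X.cone x n y) : X.Btw x p y' := by
  have := hy p hp
  unfold Btw at *
  omega

theorem le_dist_of_mem_cone (hc : X.Connected) {x y y' : V} {n : ℕ} (h : n ≤ X.dist x y)
    (hy : y' ∈ X.cone x n y) : n ≤ X.dist x y' := by
  obtain ⟨p, hp, hpn⟩ := exists_btw_dist_eq hc h
  have := hp.of_mem_cone hpn.le hy
  unfold Btw at this
  omega

/-- A second vertex `y'` of the cone would have `y` on a geodesic from `x` to it, and the next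
vertex of that geodesic, still in the ball, is closer to `y'` but not to `y`. So levels above `d(x,
y) + 1` bring no new sets; hence the bound in `IsCone`. -/
theorem cone_eq_singleton (hc : X.Connected) {x y : V} {n : ℕ} (h : X.dist x y < n) :
    X.cone x n y = {y} := by
  refine Set.Subset.antisymm (fun y' hy => ?_) (by simp [mem_cone_self])
  by_contra hne
  have h1 : X.Btw x y y' := (btw_right x y).of_mem_cone h.le hy
  obtain ⟨b, hb, hb'⟩ := exists_adj_btw hc (Ne.symm hne)
  have h2 := dist_eq_one_iff_adj.2 hb
  have h3 := h1.trans_mid' hc hb'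
  have h4 := hy b (by unfold Btw at h3; omega)
  have h5 := X.dist_comm (u := b) (v := y)
  unfold Btw at *
  omega

/-- If the geodesics towards `y` and `y'` cross a set on which `d(·, y)` and `d(·, y')` differ by a
constant, then `y` and `y'` are in the same cone. -/
theorem mem_cone_of_crossing (hc : X.Connected) {x y y' b : V} {n : ℕ} {N : Set V}
    (hN : ∀ v ∈ N, X.dist v y' + X.dist b y = X.dist v y + X.dist b y')
    (hy : ∀ u, X.dist x u ≤ n → ∃ v ∈ N, X.Btw u v y)
    (hy' : ∀ u, X.dist x u ≤ n → ∃ v ∈ N, X.Btw u v y') : y' ∈ X.cone x n y := by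
  have key : ∀ u, X.dist x u ≤ n → X.dist u y' + X.dist b y = X.dist u y + X.dist b y' := by
    intro u hu
    obtain ⟨v, hv, hvb⟩ := hy u hu
    obtain ⟨v', hv', hvb'⟩ := hy' u hu
    have h1 := hN v hv
    have h2 := hN v' hv'
    have t1 := hc.dist_triangle (u := u) (v := v) (w := y')
    have t2 := hc.dist_triangle (u := u) (v := v') (w := y)
    unfold Btw at *
    omega
  intro u hu
  have h1 := key u hu
  have h2 := key x (by simp)
  omega

/-- Boundedly many cones of level `d(x, b)` contain a vertex behind `b`. -/
theorem exists_cone_cover (hc : X.Connected) {κ : ℕ} (hT : X.ThinWalks κ) {M : ℕ → ℕ}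
    (hM : X.FineBound M) : ∃ M₁, ∀ (P : V → Prop) (x b : V), ∃ B : Finset V, B.card ≤ M₁ ∧
      (∀ y ∈ B, P y) ∧
      ∀ y, P y → X.Btw x b y → ∃ y' ∈ B, y ∈ X.cone x (X.dist x b) y' := by
  classical
  set L := 12 * κ + 10 with hL
  -- The cone of `y` is determined by `d(v, y) - d(b, y)` for at most `M L + 2` crossing points `v`.
  -- These are within `2L` of `b`, so each difference takes at most `4L + 1` values.
  refine ⟨(4 * L + 1) ^ (M L + 2), fun P x b => ?_⟩
  by_cases hxb : x = b
  · subst hxb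
    by_cases hP : ∃ y, P y
    · obtain ⟨y, hy⟩ := hP
      refine ⟨{y}, ?_, by simpa using hy, fun z _ _ => ⟨y, by simp, ?_⟩⟩
      · rw [Finset.card_singleton]; exact Nat.one_le_pow _ _ (by omega)
      · rw [dist_self, cone_zero hc]; trivial
    · exact ⟨∅, by simp, by simp, fun y hy => absurd ⟨y, hy⟩ hP⟩
  · obtain ⟨a, hba, hbax⟩ := exists_adj_btw hc (Ne.symm hxb)
    have hab := hba.symm
    have h1 := dist_eq_one_iff_adj.2 hab
    have hxa : X.dist x a + 1 = X.dist x b := by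
      have := hbax.symm
      unfold Btw at this
      omega
    obtain ⟨N₀, hN₀, hN₀'⟩ := hM s(a, b) hab L
    set N : Finset V := insert a (insert b (N₀.filter fun v => v ∈ X.loopVerts s(a, b) L)) with hN
    have hNcard : N.card ≤ M L + 2 := by
      have e1 := Finset.card_insert_le a
        (insert b (N₀.filter fun v => v ∈ X.loopVerts s(a, b) L))
      have e2 := Finset.card_insert_le b (N₀.filter fun v => v ∈ X.loopVerts s(a, b) L)
      have e3 := Finset.card_filter_le N₀ (fun v => v ∈ X.loopVerts s(a, b) L)
      have e4 := congrArg Finset.card hN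
      omega
    have hNdist : ∀ v ∈ N, X.dist v b ≤ 2 * L := by
      intro v hv
      simp only [hN, Finset.mem_insert, Finset.mem_filter] at hv
      rcases hv with rfl | rfl | ⟨-, hv⟩
      · omega
      · simp
      · exact dist_le_of_mem_loopVerts hc hv
    have hcross : ∀ y, X.Btw x b y → ∀ u, X.dist x u ≤ X.dist x b → ∃ v ∈ N, X.Btw u v y := by
      intro y hy u hu
      obtain ⟨v, hv, hv'⟩ := hT.exists_btw_mem_loopVerts hc hab hxa hy hu
      refine ⟨v, ?_, hv⟩
      simp only [hN, Finset.mem_insert, Finset.mem_filter]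
      rcases hv' with hv' | hv' | hv'
      · exact Or.inl hv'
      · exact Or.inr (Or.inl hv')
      · exact Or.inr (Or.inr ⟨hN₀' v hv', hv'⟩)
    obtain ⟨B, hB, hB', hB''⟩ := exists_finset_representatives (fun y => P y ∧ X.Btw x b y)
      (fun y => fun v : N => (X.dist v.1 y : ℤ) - X.dist b y)
      (Fintype.piFinset fun _ : N => Finset.Icc (-(2 * L : ℤ)) (2 * L)) (by
        intro y _
        rw [Fintype.mem_piFinset]
        intro v
        have h2 := hNdist v.1 v.2
        have t1 := hc.dist_triangle (u := v.1) (v := b) (w := y)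
        have t2 := hc.dist_triangle (u := b) (v := v.1) (w := y)
        have c1 := X.dist_comm (u := v.1) (v := b)
        rw [Finset.mem_Icc]
        omega)
    refine ⟨B, hB.trans ?_, fun y hy => (hB' y hy).1, fun y hP hy => ?_⟩
    · rw [Fintype.card_piFinset, Finset.prod_const, Int.card_Icc, Finset.card_univ,
        Fintype.card_coe]
      have : ((2 * L : ℤ) + 1 - -(2 * L : ℤ)).toNat = 4 * L + 1 := by omega
      rw [this]
      exact Nat.pow_le_pow_right (by omega) hNcard
    · obtain ⟨y', hy', he⟩ := hB'' y ⟨hP, hy⟩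
      refine ⟨y', hy', mem_cone_of_crossing hc (N := (N : Set V)) (b := b) (fun v hv => ?_)
        (hcross y' (hB' y' hy').2) (hcross y hy)⟩
      have := congrFun he ⟨v, hv⟩
      simp only at this
      omega

/-- The constant by which levels have to be lowered for fellow travelling geodesics to lie in
boundedly many cones. -/
theorem exists_cone_cover_fellow (hc : X.Connected) {κ : ℕ} (hT : X.ThinWalks κ)
    (hF : X.FourPoint κ) {M : ℕ → ℕ} (hM : X.FineBound M) : ∃ M₂, ∀ (x z : V) (k : ℕ),
      ∃ B : Finset V, B.card ≤ M₂ ∧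
        (∀ y ∈ B, X.dist z y + 2 * k ≤ X.dist x z + X.dist x y) ∧
        ∀ y, X.dist z y + 2 * k ≤ X.dist x z + X.dist x y →
          ∃ y' ∈ B, y ∈ X.cone x (k - (2 * κ + 1)) y' := by
  classical
  obtain ⟨M₁, hM₁⟩ := exists_cone_cover hc hT hM
  refine ⟨(M (12 * κ + 5) + 1) * M₁ + 1, fun x z k => ?_⟩
  set P : V → Prop := fun y => X.dist z y + 2 * k ≤ X.dist x z + X.dist x y with hP
  by_cases hex : ∃ y, P y
  swap
  · exact ⟨∅, by simp, by simp, fun y hy => absurd ⟨y, hy⟩ hex⟩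
  obtain ⟨y₀, hy₀⟩ := hex
  rcases Nat.eq_zero_or_pos (k - (2 * κ + 1)) with h0 | h0
  · refine ⟨{y₀}, by simp, by simpa using hy₀, fun y _ => ⟨y₀, by simp, ?_⟩⟩
    rw [h0, cone_zero hc]; trivial
  · have hkz : k ≤ X.dist x z := by
      have := hc.dist_triangle (u := x) (v := z) (w := y₀)
      simp only [hP] at hy₀
      omega
    obtain ⟨b, hb, hbk⟩ := exists_btw_dist_eq hc (x := x) (y := z) (n := k - (2 * κ + 1))
      (by omega)
    obtain ⟨a, hba, hbax⟩ := exists_adj_btw hc (x := b) (y := x) (by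
      rintro rfl
      simp at hbk
      omega)
    have hxa : X.dist x a + 1 = X.dist x b := by
      have h1 := hbax.symm
      have h2 := dist_eq_one_iff_adj.2 hba.symm
      unfold Btw at h1
      omega
    -- By fellow travelling, all the geodesics in question cross this level at `b` or on a short
    -- loop through `ab`. This leaves boundedly many entry points `b'`, with boundedly many cones
    -- behind each.
    obtain ⟨N, hN, hN'⟩ := hM s(a, b) hba.symm (12 * κ + 5)
    choose B hB hBP hB' using fun b' => hM₁ P x b'
    refine ⟨((insert b N).filter fun b' => X.dist x b' = k - (2 * κ + 1)).biUnion B, ?_, ?_, ?_⟩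
    · refine (Finset.card_biUnion_le_card_mul _ _ M₁ fun b' _ => hB b').trans ?_
      have h1 := Finset.card_filter_le (insert b N) fun b' => X.dist x b' = k - (2 * κ + 1)
      have h2 := Finset.card_insert_le b N
      refine (Nat.mul_le_mul_right M₁ (show _ ≤ M (12 * κ + 5) + 1 by omega)).trans ?_
      omega
    · intro y hy
      obtain ⟨b', -, hy⟩ := Finset.mem_biUnion.1 hy
      exact hBP b' y hy
    · intro y hy
      have hky : k ≤ X.dist x y := by
        have := hc.dist_triangle (u := x) (v := y) (w := z)
        have := X.dist_comm (u := y) (v := z)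
        omega
      obtain ⟨b', hb', hbk'⟩ := exists_btw_dist_eq hc (x := x) (y := y)
        (n := k - (2 * κ + 1)) (by omega)
      have hmem := hF.mem_loopVerts_of_btw hc hba.symm hxa hb hb' (by omega) (by omega)
      obtain ⟨y', hy', hyy'⟩ := hB' b' y hy hb'
      refine ⟨y', Finset.mem_biUnion.2 ⟨b', Finset.mem_filter.2 ⟨?_, hbk'⟩, hy'⟩, hbk' ▸ hyy'⟩
      rcases hmem with h | h
      · exact Finset.mem_insert.2 (Or.inl h)
      · exact Finset.mem_insert_of_mem (hN' _ h)

/-- All but boundedly many subcones of the next level lie on the same side of a given cone around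
another vertex. -/
theorem exists_children_cover (hc : X.Connected) {κ : ℕ} (hT : X.ThinWalks κ) {M : ℕ → ℕ}
    (hM : X.FineBound M) : ∃ M₃, ∀ (x p y₀ : V), X.Btw x p y₀ → ∀ (x' : V) (m : ℕ) (a : V),
      ∃ B : Finset V, B.card ≤ M₃ ∧ (∀ b ∈ B, b ∈ X.cone x' m a) ∧
        ((∀ y ∈ X.cone x' m a, y ∉ X.cone x (X.dist x p) y₀ → ∃ b ∈ B, y ∈ X.cone x' (m + 1) b) ∨
        (∀ y ∈ X.cone x' m a, y ∈ X.cone x (X.dist x p) y₀ →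
          ∃ b ∈ B, y ∈ X.cone x' (m + 1) b)) := by
  classical
  obtain ⟨M₁, hM₁⟩ := exists_cone_cover hc hT hM
  -- Room for two walks from `ThinWalks.exists_walk_avoiding` and the two edges at `p'`.
  set L := 32 * κ + 38 with hL
  refine ⟨(M L + 1) * M₁ + 1, fun x p y₀ hp x' m a => ?_⟩
  suffices h : ∃ B : Finset V, B.card ≤ (M L + 1) * M₁ + 1 ∧
        ((∀ y ∈ X.cone x' m a, y ∉ X.cone x (X.dist x p) y₀ → ∃ b ∈ B, y ∈ X.cone x' (m + 1) b) ∨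
        (∀ y ∈ X.cone x' m a, y ∈ X.cone x (X.dist x p) y₀ →
          ∃ b ∈ B, y ∈ X.cone x' (m + 1) b)) by
    obtain ⟨B, hB, hB'⟩ := h
    refine ⟨B.filter (· ∈ X.cone x' m a), (Finset.card_filter_le _ _).trans hB, by simp, ?_⟩
    have key : ∀ y ∈ X.cone x' m a, (∃ b ∈ B, y ∈ X.cone x' (m + 1) b) →
        ∃ b ∈ B.filter (· ∈ X.cone x' m a), y ∈ X.cone x' (m + 1) b := by
      rintro y hy ⟨b, hb, hyb⟩
      refine ⟨b, Finset.mem_filter.2 ⟨hb, ?_⟩, hyb⟩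
      rw [← cone_eq_of_mem hy]
      exact cone_anti (Nat.le_succ m) (mem_cone_symm hyb)
    rcases hB' with hB' | hB'
    · exact Or.inl fun y hy hy' => key y hy (hB' y hy hy')
    · exact Or.inr fun y hy hy' => key y hy (hB' y hy hy')
  by_cases hm : X.dist x' a < m
  · refine ⟨{a}, by simp, Or.inr fun y hy _ => ⟨a, by simp, ?_⟩⟩
    rw [cone_eq_singleton hc hm, Set.mem_singleton_iff] at hy
    rw [hy]
    exact mem_cone_self _ _ _
  push Not at hm
  by_cases hx : X.dist x p = 0
  · refine ⟨∅, by simp, Or.inl fun y _ hy => absurd ?_ hy⟩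
    rw [hx, cone_zero hc]; trivial
  obtain ⟨p', hp', hpm⟩ := exists_btw_dist_eq hc hm
  -- All of the cone lies behind `p'`. Apart from `p'` itself, its vertices are reached by a step at
  -- a small angle to `c`, which accounts for boundedly many children, or by a step at a large
  -- angle.
  have main : ∀ c, X.Adj p' c → ∃ B : Finset V, B.card ≤ (M L + 1) * M₁ + 1 ∧
      ∀ y ∈ X.cone x' m a, (∃ b ∈ B, y ∈ X.cone x' (m + 1) b) ∨
        ∃ b, X.Adj p' b ∧ X.Btw p' b y ∧ b ≠ c ∧ b ∉ X.loopVerts s(p', c) L := by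
    intro c hcp
    obtain ⟨N, hN, hN'⟩ := hM s(p', c) hcp L
    choose B hB _ hB' using fun b => hM₁ (fun _ => True) x' b
    refine ⟨insert p' ((insert c N).biUnion B), ?_, fun y hy => ?_⟩
    · have h1 := Finset.card_insert_le p' ((insert c N).biUnion B)
      have h2 := Finset.card_biUnion_le_card_mul (insert c N) B M₁ fun b _ => hB b
      have h3 := Finset.card_insert_le c N
      have h4 := Nat.mul_le_mul_right M₁ (show (insert c N).card ≤ M L + 1 by omega)
      omega
    · have hyp := hp'.of_mem_cone hpm.le hy
      by_cases hyp' : p' = y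
      · exact Or.inl ⟨p', by simp, hyp' ▸ mem_cone_self _ _ _⟩
      obtain ⟨b, hb, hby⟩ := exists_adj_btw hc hyp'
      by_cases hbN : b ∈ insert c N
      · obtain ⟨z, hz, hyz⟩ := hB' b y trivial (hyp.trans_right hc hby)
        refine Or.inl ⟨z, Finset.mem_insert_of_mem (Finset.mem_biUnion.2 ⟨b, hbN, hz⟩), ?_⟩
        have h1 := hyp.trans_mid' hc hby
        have h2 := dist_eq_one_iff_adj.2 hb
        unfold Btw at h1
        rwa [show m + 1 = X.dist x' b by omega]
      · rw [Finset.mem_insert, not_or] at hbN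
        exact Or.inr ⟨b, hb, hby, hbN.1, fun h => hbN.2 (hN' b h)⟩
  -- If `p'` is at least as far from `x` as `p`, take for `c` the direction of `x`. A large angle
  -- forces all geodesics from the ball of radius `d(x, p)` to `y` through `p'`, so `y` is on the
  -- side of `p'`.
  by_cases hs : X.dist x p ≤ X.dist x p'
  · obtain ⟨c, hpc, hcx⟩ := exists_adj_btw hc (x := p') (y := x) (by
      rintro rfl
      rw [dist_self] at hs
      omega)
    obtain ⟨B, hB, hB'⟩ := main c hpc
    refine ⟨B, hB, ?_⟩
    have key : ∀ y ∈ X.cone x' m a, (∃ b ∈ B, y ∈ X.cone x' (m + 1) b) ∨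
        y ∈ X.cone x (X.dist x p) p' := by
      intro y hy
      refine (hB' y hy).imp id ?_
      rintro ⟨b, hpb, hby, hbc, hbL⟩
      have hbtw : ∀ u, X.dist x u ≤ X.dist x p → X.Btw u p' y := by
        intro u hu
        by_contra hno
        have hpu : p' ≠ u := by
          rintro rfl
          exact hno (btw_left _ _)
        -- The angle between `b` and `c` is estimated through the direction `c'` of `u`. Both parts
        -- are small: `p'` is not between `u` and `y`, nor between `x` and `u`, being at least as
        -- far from `x` as `u`.
        obtain ⟨c', hpc', hcu⟩ := exists_adj_btw hc hpu
        obtain ⟨r, hr, hl⟩ := hT.exists_walk_avoiding hc hpc' hcu hpb hby hno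
        obtain ⟨r', hr', hl'⟩ := hT.exists_walk_avoiding hc hpc hcx hpc' hcu (by
          intro h
          have := hc.pos_dist_of_ne hpu
          unfold Btw at h
          omega)
        refine hbL (mem_loopVerts_of_walk hpb hpc hbc (r.append r') ?_ ?_)
        · rw [Walk.mem_support_append_iff]; tauto
        · rw [Walk.length_append]; omega
      intro u hu
      have h1 := hbtw u hu
      have h2 := hbtw x (by simp)
      unfold Btw at h1 h2
      omega
    by_cases hpS : p' ∈ X.cone x (X.dist x p) y₀
    · refine Or.inl fun y hy hyS => (key y hy).resolve_right fun h => hyS ?_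
      rwa [cone_eq_of_mem hpS] at h
    · refine Or.inr fun y hy hyS => (key y hy).resolve_right fun h => hpS ?_
      rw [← cone_eq_of_mem hyS]
      exact mem_cone_symm h
  -- If `p'` is closer to `x` than `p`, it is not on a geodesic from `p` to a vertex `y` of the cone
  -- around `x`. So such `y` make a small angle with the direction of `p`.
  · push Not at hs
    obtain ⟨c, hpc, hcp⟩ := exists_adj_btw hc (x := p') (y := p) (by
      rintro rfl
      omega)
    obtain ⟨B, hB, hB'⟩ := main c hpc
    refine ⟨B, hB, Or.inr fun y hy hyS => (hB' y hy).resolve_right ?_⟩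
    rintro ⟨b, hpb, hby, hbc, hbL⟩
    have hxpy := hp.of_mem_cone le_rfl hyS
    have hno : ¬ X.Btw p p' y := by
      intro h
      have t := hc.dist_triangle (u := x) (v := p') (w := y)
      unfold Btw at h hxpy
      omega
    obtain ⟨r, hr, hl⟩ := hT.exists_walk_avoiding hc hpc hcp hpb hby hno
    exact hbL (mem_loopVerts_of_walk hpb hpc hbc r hr (by omega))

/-- A cone of sufficiently high level is on one side of a given cone around another vertex. -/
theorem FourPoint.cone_subset_cone (hc : X.Connected) {κ : ℕ} (hF : X.FourPoint κ)
    {x p y₀ x' y : V} {l : ℕ} (hp : X.Btw x p y₀) (hl : X.dist x' p + (3 * κ + 1) ≤ l)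
    (hy : y ∈ X.cone x (X.dist x p) y₀) : X.cone x' l y ⊆ X.cone x (X.dist x p) y₀ := by
  by_cases hsing : X.dist x' y < l
  · rw [cone_eq_singleton hc hsing]
    simpa using hy
  push Not at hsing
  intro y' hy'
  rw [← cone_eq_of_mem hy]
  have hxpy := hp.of_mem_cone le_rfl hy
  have tpy := hc.dist_triangle (u := x') (v := p) (w := y)
  -- Geodesics from the ball around `x` to vertices beyond `q` pass within `2κ` of `q`, or else an
  -- endpoint is near `p` or `q`. In all cases they meet the ball of radius `l` around `x'`, where
  -- `d(·, y)` and `d(·, y')` differ by a constant.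
  obtain ⟨q, hq, hpq⟩ := exists_btw_dist_eq hc (x := p) (y := y) (n := κ + 1) (by omega)
  have hxpq := hxpy.trans_mid' hc hq
  have tq := hc.dist_triangle (u := x') (v := p) (w := q)
  have hq' : X.Btw p q y' := by
    have h1 := hy' p (by omega)
    have h2 := hy' q (by omega)
    unfold Btw at *
    omega
  have cross : ∀ t, X.Btw p q t → ∀ u, X.dist x u ≤ X.dist x p →
      ∃ v ∈ {v | X.dist x' v ≤ l}, X.Btw u v t := by
    intro t ht u hu
    by_cases hup : X.dist u p ≤ κ
    · refine ⟨u, ?_, btw_left _ _⟩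
      have t1 := hc.dist_triangle (u := x') (v := p) (w := u)
      have c1 := X.dist_comm (u := p) (v := u)
      simp only [Set.mem_ofPred_eq]
      omega
    have f1 := hF x q u p
    have f2 := hF p t u q
    have c1 := X.dist_comm (u := q) (v := u)
    have c2 := X.dist_comm (u := p) (v := u)
    have c3 := X.dist_comm (u := q) (v := p)
    have c4 := X.dist_comm (u := t) (v := q)
    have c5 := X.dist_comm (u := t) (v := u)
    have hprod : X.dist u q + X.dist q t ≤ X.dist u t + κ := by
      unfold Btw at hxpq ht
      omega
    by_cases huq : X.dist u q ≤ X.dist u t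
    · obtain ⟨v, hv, huv⟩ := exists_btw_dist_eq hc huq
      refine ⟨v, ?_, hv⟩
      have f3 := hF u t v q
      have c6 := X.dist_comm (u := t) (v := v)
      have c7 := X.dist_comm (u := v) (v := q)
      have t1 := hc.dist_triangle (u := x') (v := q) (w := v)
      simp only [Set.mem_ofPred_eq]
      unfold Btw at hv
      omega
    · refine ⟨t, ?_, btw_right _ _⟩
      have t1 := hc.dist_triangle (u := x') (v := q) (w := t)
      simp only [Set.mem_ofPred_eq]
      omega
  exact mem_cone_of_crossing hc (N := {v | X.dist x' v ≤ l}) (b := x') (fun v hv => hy' v hv)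
    (cross y hq) (cross y' hq')

end Cone

end SimpleGraph

/-- The sum of the values of `f` over the set `S`. -/
noncomputable def mass {V : Type*} (f : V →₀ ℂ) (S : Set V) : ℂ :=
  ∑ y ∈ f.support, S.indicator f y

/-! ### Masses of sets -/

section Mass

variable {V : Type*} (f : V →₀ ℂ)

@[simp]
theorem mass_empty : mass f ∅ = 0 := by simp [mass]

theorem mass_inter_add_diff (S A : Set V) : mass f (S ∩ A) + mass f (S \ A) = mass f S := by
  unfold mass
  rw [← Finset.sum_add_distrib]
  refine Finset.sum_congr rfl fun y _ => ?_
  by_cases h1 : y ∈ S <;> by_cases h2 : y ∈ A <;> simp [h1, h2]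

theorem norm_mass_diff_le (S A : Set V) : ‖mass f (S \ A)‖ ≤ ‖mass f S‖ + ‖mass f (S ∩ A)‖ := by
  rw [← mass_inter_add_diff f S A]
  calc ‖mass f (S \ A)‖ = ‖mass f (S ∩ A) + mass f (S \ A) - mass f (S ∩ A)‖ := by ring_nf
    _ ≤ _ := norm_sub_le _ _

theorem norm_mass_inter_le (S A : Set V) : ‖mass f (S ∩ A)‖ ≤ ‖mass f S‖ + ‖mass f (S \ A)‖ := by
  rw [← mass_inter_add_diff f S A]
  calc ‖mass f (S ∩ A)‖ = ‖mass f (S ∩ A) + mass f (S \ A) - mass f (S \ A)‖ := by ring_nf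
    _ ≤ _ := norm_sub_le _ _

theorem norm_mass_le_add (S A : Set V) : ‖mass f S‖ ≤ ‖mass f (S ∩ A)‖ + ‖mass f (S \ A)‖ := by
  rw [← mass_inter_add_diff f S A]
  exact norm_add_le _ _

theorem mass_eq_sum {T : Set V} (C : Finset (Set V))
    (hC : ∀ A ∈ C, ∀ B ∈ C, ∀ y ∈ A, y ∈ B → A = B) (hT : ∀ y ∈ T, ∃ A ∈ C, y ∈ A) :
    mass f T = ∑ A ∈ C, mass f (T ∩ A) := by
  unfold mass
  rw [Finset.sum_comm]
  refine Finset.sum_congr rfl fun y _ => ?_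
  by_cases hy : y ∈ T
  · obtain ⟨A, hA, hyA⟩ := hT y hy
    rw [Finset.sum_eq_single_of_mem A hA]
    · simp [hy, hyA]
    · intro B hB hne
      have : y ∉ B := fun h => hne (hC B hB A hA y h hyA)
      simp [this]
  · simp [hy]

theorem norm_mass_le_sum {ι : Type*} {T : Set V} (B : Finset ι) (c : ι → Set V)
    (hc : ∀ a ∈ B, ∀ b ∈ B, ∀ y ∈ c a, y ∈ c b → c a = c b) (hT : ∀ y ∈ T, ∃ b ∈ B, y ∈ c b) :
    ‖mass f T‖ ≤ ∑ b ∈ B, ‖mass f (T ∩ c b)‖ := by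
  classical
  -- Different indices may name the same set, so the sum is taken over the sets.
  rw [mass_eq_sum f (B.image c)]
  · refine (norm_sum_le _ _).trans ?_
    exact Finset.sum_image_le_of_nonneg (g := c) (f := fun A => ‖mass f (T ∩ A)‖)
      (fun _ _ => norm_nonneg _)
  · intro A hA A' hA' y hy hy'
    obtain ⟨a, ha, rfl⟩ := Finset.mem_image.1 hA
    obtain ⟨b, hb, rfl⟩ := Finset.mem_image.1 hA'
    exact hc a ha b hb y hy hy'
  · intro y hy
    obtain ⟨b, hb, hyb⟩ := hT y hy
    exact ⟨c b, Finset.mem_image_of_mem c hb, hyb⟩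

end Mass

/-- Double counting. With squared masses as weights it turns the domination of single cones into a
comparison of energies. -/
theorem sum_sum_le_of_card_le {α β : Type*} [DecidableEq β] (T : Finset α) (F : α → Finset β)
    (w : β → ℝ) (hw : ∀ b, 0 ≤ w b) {m : ℕ}
    (hm : ∀ b, ∀ T' ⊆ T, (∀ t ∈ T', b ∈ F t) → T'.card ≤ m) :
    ∑ t ∈ T, ∑ b ∈ F t, w b ≤ m * ∑ b ∈ T.biUnion F, w b := by
  classical
  calc ∑ t ∈ T, ∑ b ∈ F t, w b
      = ∑ t ∈ T, ∑ b ∈ T.biUnion F, if b ∈ F t then w b else 0 := by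
        refine Finset.sum_congr rfl fun t ht => ?_
        rw [← Finset.sum_filter]
        refine Finset.sum_congr ?_ fun _ _ => rfl
        ext b
        simp only [Finset.mem_filter, Finset.mem_biUnion]
        exact ⟨fun h => ⟨⟨t, ht, h⟩, h⟩, fun h => h.2⟩
    _ = ∑ b ∈ T.biUnion F, ∑ t ∈ T, if b ∈ F t then w b else 0 := Finset.sum_comm
    _ ≤ ∑ b ∈ T.biUnion F, m * w b := by
        refine Finset.sum_le_sum fun b _ => ?_
        rw [← Finset.sum_filter, Finset.sum_const, nsmul_eq_mul]
        refine mul_le_mul_of_nonneg_right ?_ (hw b)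
        exact_mod_cast hm b _ (Finset.filter_subset _ _) fun t ht => (Finset.mem_filter.1 ht).2
    _ = _ := by rw [Finset.mul_sum]

theorem sq_sum_le_card_mul {β : Type*} (F : Finset β) (w : β → ℝ) {M : ℕ} (hM : F.card ≤ M) :
    (∑ i ∈ F, w i) ^ 2 ≤ M * ∑ i ∈ F, w i ^ 2 := by
  refine sq_sum_le_card_mul_sum_sq.trans ?_
  exact mul_le_mul_of_nonneg_right (by exact_mod_cast hM) (Finset.sum_nonneg fun _ _ => sq_nonneg _)

/-! ### Domination by cones around another vertex -/

namespace SimpleGraph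

/-- `(n, S)` consists of a level and a cone of that level around `x`. -/
def IsCone {V : Type*} (X : SimpleGraph V) (x : V) (i : ℕ × Set V) : Prop :=
  ∃ y, i.1 ≤ X.dist x y + 1 ∧ i.2 = X.cone x i.1 y

/-- The functional `φ` is dominated by the masses of at most `M` cones around `x` from `F`. -/
structure Dominated {V : Type*} (X : SimpleGraph V) (x : V) (φ : (V →₀ ℂ) → ℝ)
    (F : Finset (ℕ × Set V)) (M : ℕ) : Prop where
  card_le : F.card ≤ M
  isCone : ∀ i ∈ F, X.IsCone x i
  le : ∀ f, φ f ≤ M * ∑ i ∈ F, ‖mass f i.2‖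

/-- The cone of level `m` of `b` around `x` is contained in `S`, or it lies in `S` up to at most `K`
subcones of the next level but it is not covered by `2 * K` of these. -/
def Robust {V : Type*} (X : SimpleGraph V) (K : ℕ) (x : V) (m : ℕ) (b : V) (S : Set V) : Prop :=
  X.cone x m b ⊆ S ∨
    ((∃ B : Finset V, B.card ≤ K ∧ ∀ y ∈ X.cone x m b, y ∉ S → ∃ c ∈ B, y ∈ X.cone x (m + 1) c) ∧
      ¬ ∃ B : Finset V, B.card ≤ 2 * K ∧ ∀ y ∈ X.cone x m b, ∃ c ∈ B, y ∈ X.cone x (m + 1) c)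

section Dominated

variable {V : Type*} {X : SimpleGraph V} {x : V}

theorem Dominated.mono {φ ψ : (V →₀ ℂ) → ℝ} {F : Finset (ℕ × Set V)} {M N : ℕ}
    (h : X.Dominated x φ F M) (hψ : ∀ f, ψ f ≤ φ f) (hN : M ≤ N) : X.Dominated x ψ F N where
  card_le := h.card_le.trans hN
  isCone := h.isCone
  le f := by
    refine ((hψ f).trans (h.le f)).trans ?_
    exact mul_le_mul_of_nonneg_right (by exact_mod_cast hN)
      (Finset.sum_nonneg fun _ _ => norm_nonneg _)

theorem Dominated.zero : X.Dominated x (fun _ => 0) ∅ 0 where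
  card_le := by simp
  isCone := by simp
  le f := by simp

theorem IsCone.dominated {i : ℕ × Set V} (h : X.IsCone x i) :
    X.Dominated x (fun f => ‖mass f i.2‖) {i} 1 where
  card_le := by simp
  isCone := by simpa using h
  le f := by simp

theorem Dominated.add [DecidableEq (ℕ × Set V)] {φ ψ : (V →₀ ℂ) → ℝ} {F G : Finset (ℕ × Set V)}
    {M N : ℕ} (hφ : X.Dominated x φ F M) (hψ : X.Dominated x ψ G N) :
    X.Dominated x (fun f => φ f + ψ f) (F ∪ G) (M + N) where
  card_le := (Finset.card_union_le _ _).trans (add_le_add hφ.card_le hψ.card_le)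
  isCone i hi := (Finset.mem_union.1 hi).elim (hφ.isCone i) (hψ.isCone i)
  le f := by
    have h1 : ∑ i ∈ F, ‖mass f i.2‖ ≤ ∑ i ∈ F ∪ G, ‖mass f i.2‖ :=
      Finset.sum_le_sum_of_subset_of_nonneg Finset.subset_union_left fun _ _ _ => norm_nonneg _
    have h2 : ∑ i ∈ G, ‖mass f i.2‖ ≤ ∑ i ∈ F ∪ G, ‖mass f i.2‖ :=
      Finset.sum_le_sum_of_subset_of_nonneg Finset.subset_union_right fun _ _ _ => norm_nonneg _
    have h3 := hφ.le f
    have h4 := hψ.le f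
    have h5 := mul_le_mul_of_nonneg_left h1 (Nat.cast_nonneg (α := ℝ) M)
    have h6 := mul_le_mul_of_nonneg_left h2 (Nat.cast_nonneg (α := ℝ) N)
    push_cast
    linarith

theorem Dominated.sum [DecidableEq (ℕ × Set V)] {ι : Type*} {φ : ι → (V →₀ ℂ) → ℝ}
    {F : ι → Finset (ℕ × Set V)} {M K : ℕ} (B : Finset ι) (hB : B.card ≤ K)
    (h : ∀ b ∈ B, X.Dominated x (φ b) (F b) M) :
    X.Dominated x (fun f => ∑ b ∈ B, φ b f) (B.biUnion F) (K * M) where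
  card_le := (Finset.card_biUnion_le_card_mul _ _ M fun b hb => (h b hb).card_le).trans
    (Nat.mul_le_mul_right _ hB)
  isCone i hi := by
    obtain ⟨b, hb, hi⟩ := Finset.mem_biUnion.1 hi
    exact (h b hb).isCone i hi
  le f := by
    set s := ∑ i ∈ B.biUnion F, ‖mass f i.2‖ with hs
    have hs0 : 0 ≤ s := Finset.sum_nonneg fun _ _ => norm_nonneg _
    calc ∑ b ∈ B, φ b f ≤ ∑ b ∈ B, M * s := by
          refine Finset.sum_le_sum fun b hb => ((h b hb).le f).trans ?_
          exact mul_le_mul_of_nonneg_left (Finset.sum_le_sum_of_subset_of_nonneg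
            (Finset.subset_biUnion_of_mem F hb) fun _ _ _ => norm_nonneg _) (Nat.cast_nonneg _)
      _ = B.card * (M * s) := by rw [Finset.sum_const, nsmul_eq_mul]
      _ ≤ K * (M * s) := mul_le_mul_of_nonneg_right (by exact_mod_cast hB) (by positivity)
      _ = _ := by push_cast; ring

theorem cone_eq_or {n : ℕ} {a b y : V} (ha : y ∈ X.cone x n a) (hb : y ∈ X.cone x n b) :
    X.cone x n a = X.cone x n b := by
  rw [← cone_eq_of_mem ha, cone_eq_of_mem hb]

/-- Distinct cones of one level are disjoint, so two of them cannot both contain a robust cone up to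
`K` children: together the exceptions would cover it by `2K` children. Thus a robust cone around
`x'` remembers the cone around `x` of given level that it serves. -/
theorem Robust.eq_of_cone {K m n : ℕ} {x' b y y' : V} (h : X.Robust K x' m b (X.cone x n y))
    (h' : X.Robust K x' m b (X.cone x n y')) : X.cone x n y = X.cone x n y' := by
  classical
  by_contra hne
  have hdisj : ∀ z, z ∈ X.cone x n y → z ∉ X.cone x n y' := fun z hz hz' => hne (cone_eq_or hz hz')
  rcases h with h | ⟨⟨B, hB, hB'⟩, hno⟩
  · rcases h' with h' | ⟨⟨B, hB, hB'⟩, hno⟩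
    · exact hdisj b (h (mem_cone_self _ _ _)) (h' (mem_cone_self _ _ _))
    · exact hno ⟨B, by omega, fun z hz => hB' z hz (hdisj z (h hz))⟩
  · rcases h' with h' | ⟨⟨B', hB₁, hB₁'⟩, -⟩
    · exact hno ⟨B, by omega, fun z hz => hB' z hz fun hz' => hdisj z hz' (h' hz)⟩
    · refine hno ⟨B ∪ B', (Finset.card_union_le _ _).trans (by omega), fun z hz => ?_⟩
      by_cases hzy : z ∈ X.cone x n y
      · obtain ⟨c, hc, hzc⟩ := hB₁' z hz (hdisj z hzy)
        exact ⟨c, Finset.mem_union_right _ hc, hzc⟩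
      · obtain ⟨c, hc, hzc⟩ := hB' z hz hzy
        exact ⟨c, Finset.mem_union_left _ hc, hzc⟩

/-- A cone `(i.1, i.2)` contained in the cone of level `l` of `a` and contained, up to at most one
level, in a robust cone. -/
def Anchored (X : SimpleGraph V) (K : ℕ) (x : V) (l : ℕ) (a : V) (S : Set V) (i : ℕ × Set V) :
    Prop :=
  ∃ m b, l ≤ m ∧ m ≤ i.1 ∧ i.1 ≤ m + 1 ∧ i.2 ⊆ X.cone x m b ∧ b ∈ X.cone x l a ∧
    X.Robust K x m b S

theorem Anchored.of_child {K l : ℕ} {a b : V} {S : Set V} {i : ℕ × Set V}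
    (h : X.Anchored K x (l + 1) b S i) (hb : b ∈ X.cone x l a) : X.Anchored K x l a S i := by
  obtain ⟨m, c, h1, h2, h3, h4, h5, h6⟩ := h
  refine ⟨m, c, by omega, h2, h3, h4, ?_, h6⟩
  rw [← cone_eq_of_mem hb]
  exact cone_anti (Nat.le_succ l) h5

/-- The intersection of two cones around different vertices is dominated by boundedly many cones
around one of these vertices. -/
theorem exists_dominated_inter (hc : X.Connected) {κ : ℕ} (hT : X.ThinWalks κ)
    (hF : X.FourPoint κ) {M : ℕ → ℕ} (hM : X.FineBound M) : ∃ K, ∀ J : ℕ, ∃ N, ∀ (x p y₀ : V),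
      X.Btw x p y₀ → ∀ (x' : V) (l : ℕ) (a : V), X.dist x' p + (3 * κ + 1) ≤ l + J →
      l ≤ X.dist x' a + 1 → ∃ F,
        X.Dominated x' (fun f => ‖mass f (X.cone x (X.dist x p) y₀ ∩ X.cone x' l a)‖) F N ∧
        ∀ i ∈ F, i.1 ≤ l + J ∧ X.Anchored K x' l a (X.cone x (X.dist x p) y₀) i := by
  classical
  obtain ⟨K, hK⟩ := exists_children_cover hc hT hM
  refine ⟨K, fun J => ?_⟩
  have triv : ∀ (x p y₀ x' : V) (l : ℕ) (a : V) (J N : ℕ), l ≤ X.dist x' a + 1 → 1 ≤ N →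
      (X.cone x (X.dist x p) y₀ ∩ X.cone x' l a = ∅ ∨
        X.cone x' l a ⊆ X.cone x (X.dist x p) y₀) → ∃ F,
        X.Dominated x' (fun f => ‖mass f (X.cone x (X.dist x p) y₀ ∩ X.cone x' l a)‖) F N ∧
        ∀ i ∈ F, i.1 ≤ l + J ∧ X.Anchored K x' l a (X.cone x (X.dist x p) y₀) i := by
    intro x p y₀ x' l a J N hl hN h
    rcases h with h | h
    · exact ⟨∅, Dominated.zero.mono (by simp [h]) (by omega), by simp⟩
    · refine ⟨{(l, X.cone x' l a)}, (IsCone.dominated ⟨a, hl, rfl⟩).mono (fun f => ?_) hN, ?_⟩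
      · rw [Set.inter_eq_right.2 h]
      · intro i hi
        rw [Finset.mem_singleton] at hi
        subst hi
        exact ⟨by simp, l, a, le_rfl, le_rfl, by simp, subset_rfl, mem_cone_self _ _ _, Or.inl h⟩
  -- `J` bounds how far `l` is below the level from which `FourPoint.cone_subset_cone` leaves only
  -- the cases of inclusion and disjointness.
  induction J with
  | zero =>
    refine ⟨1, fun x p y₀ hp x' l a hl hla => triv x p y₀ x' l a 0 1 hla le_rfl ?_⟩
    rw [← Set.not_nonempty_iff_eq_empty]
    by_cases h : (X.cone x (X.dist x p) y₀ ∩ X.cone x' l a).Nonempty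
    · obtain ⟨y, hy, hya⟩ := h
      right
      rw [← cone_eq_of_mem hya]
      exact hF.cone_subset_cone hc hp (by omega) hy
    · exact Or.inl h
  | succ J ih =>
    obtain ⟨N, hN⟩ := ih
    refine ⟨1 + K + 2 * K * N, fun x p y₀ hp x' l a hl hla => ?_⟩
    set S := X.cone x (X.dist x p) y₀ with hS
    set A := X.cone x' l a with hA
    by_cases hemp : S ∩ A = ∅
    · exact triv x p y₀ x' l a (J + 1) _ hla (by omega) (Or.inl hemp)
    by_cases hsub : A ⊆ S
    · exact triv x p y₀ x' l a (J + 1) _ hla (by omega) (Or.inr hsub)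
    have hla' : l ≤ X.dist x' a := by
      by_contra hlt
      push Not at hlt
      have h1 : A = {a} := cone_eq_singleton hc hlt
      obtain ⟨y, hyS, hyA⟩ := Set.nonempty_iff_ne_empty.2 hemp
      rw [h1, Set.mem_singleton_iff] at hyA
      refine hsub ?_
      rw [h1, Set.singleton_subset_iff, ← hyA]
      exact hyS
    have hchild : ∀ b, ∃ F, b ∈ A →
        X.Dominated x' (fun f => ‖mass f (S ∩ X.cone x' (l + 1) b)‖) F N ∧
        ∀ i ∈ F, i.1 ≤ l + (J + 1) ∧ X.Anchored K x' l a S i := by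
      intro b
      by_cases hb : b ∈ A
      · obtain ⟨F, hF₁, hF₂⟩ := hN x p y₀ hp x' (l + 1) b (by omega)
          (by have := le_dist_of_mem_cone hc hla' hb; omega)
        exact ⟨F, fun _ => ⟨hF₁, fun i hi => ⟨by have := (hF₂ i hi).1; omega,
          (hF₂ i hi).2.of_child hb⟩⟩⟩
      · exact ⟨∅, fun h => absurd h hb⟩
    choose F hF' using hchild
    have hcA : ∀ b ∈ A, X.cone x' (l + 1) b ⊆ A := fun b hb => by
      rw [hA, ← cone_eq_of_mem hb]
      exact cone_anti (Nat.le_succ l)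
    have covered : ∀ B : Finset V, B.card ≤ 2 * K → (∀ b ∈ B, b ∈ A) →
        (∀ y ∈ A, y ∈ S → ∃ b ∈ B, y ∈ X.cone x' (l + 1) b) → ∃ F,
        X.Dominated x' (fun f => ‖mass f (S ∩ A)‖) F (1 + K + 2 * K * N) ∧
        ∀ i ∈ F, i.1 ≤ l + (J + 1) ∧ X.Anchored K x' l a S i := by
      intro B hB hBA hcov
      refine ⟨B.biUnion F, (Dominated.sum B hB fun b hb => (hF' b (hBA b hb)).1).mono
        (fun f => ?_) (by omega), ?_⟩
      · refine (norm_mass_le_sum f B (fun b => X.cone x' (l + 1) b)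
          (fun b _ c _ y hy hy' => cone_eq_or hy hy') fun y hy => hcov y hy.2 hy.1).trans_eq ?_
        refine Finset.sum_congr rfl fun b hb => ?_
        rw [Set.inter_assoc, Set.inter_eq_right.2 (hcA b (hBA b hb))]
      · intro i hi
        obtain ⟨b, hb, hi⟩ := Finset.mem_biUnion.1 hi
        exact (hF' b (hBA b hb)).2 i hi
    -- If few children cover `S ∩ A`, their parts in `S` are added up. If few cover `A \ S`, the
    -- mass of `S ∩ A` is that of `A` minus that of these exceptions. The latter is done only if `A`
    -- has many children, so that `A` is robust.
    obtain ⟨B, hB, hBA, hB'⟩ := hK x p y₀ hp x' l a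
    rcases hB' with hB' | hB'
    · by_cases hsmall : ∃ B : Finset V, B.card ≤ 2 * K ∧
          ∀ y ∈ A, ∃ c ∈ B, y ∈ X.cone x' (l + 1) c
      · obtain ⟨B₂, hB₂, hB₂'⟩ := hsmall
        refine covered (B₂.filter (· ∈ A)) ((Finset.card_filter_le _ _).trans hB₂) (by simp) ?_
        intro y hy _
        obtain ⟨c, hcB, hyc⟩ := hB₂' y hy
        refine ⟨c, Finset.mem_filter.2 ⟨hcB, ?_⟩, hyc⟩
        rw [hA, ← cone_eq_of_mem hy]
        exact cone_anti (Nat.le_succ l) (mem_cone_symm hyc)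
      · have hrob : X.Robust K x' l a S := Or.inr ⟨⟨B, hB, hB'⟩, hsmall⟩
        have d1 := (IsCone.dominated (X := X) (x := x') (i := (l, A)) ⟨a, hla, rfl⟩)
        have d2 := Dominated.sum (X := X) (x := x') B hB fun b hb =>
          IsCone.dominated (i := (l + 1, X.cone x' (l + 1) b))
            ⟨b, by have := le_dist_of_mem_cone hc hla' (hBA b hb); simp only; omega, rfl⟩
        have d3 := Dominated.sum B hB fun b hb => (hF' b (hBA b hb)).1
        refine ⟨_, ((d1.add d2).add d3).mono (fun f => ?_) (by
          rw [mul_one, show 2 * K * N = K * N + K * N by ring]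
          exact Nat.add_le_add_left (Nat.le_add_left _ _) _), ?_⟩
        · have h1 := norm_mass_inter_le f A S
          rw [Set.inter_comm] at h1
          have h2 := norm_mass_le_sum f (T := A \ S) B (fun b => X.cone x' (l + 1) b)
            (fun b _ c _ y hy hy' => cone_eq_or hy hy') fun y hy => hB' y hy.1 hy.2
          have h3 : ∀ b ∈ B, ‖mass f ((A \ S) ∩ X.cone x' (l + 1) b)‖ ≤
              ‖mass f (X.cone x' (l + 1) b)‖ + ‖mass f (S ∩ X.cone x' (l + 1) b)‖ := by
            intro b hb
            have h4 : (A \ S) ∩ X.cone x' (l + 1) b = X.cone x' (l + 1) b \ S := by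
              ext y
              have : y ∈ X.cone x' (l + 1) b → y ∈ A := fun h => hcA b (hBA b hb) h
              simp only [Set.mem_inter_iff, Set.mem_sdiff]
              tauto
            rw [h4, Set.inter_comm S]
            exact norm_mass_diff_le _ _ _
          have h5 := Finset.sum_le_sum h3
          rw [Finset.sum_add_distrib] at h5
          linarith
        · intro i hi
          simp only [Finset.mem_union, Finset.mem_biUnion, Finset.mem_singleton] at hi
          rcases hi with (rfl | ⟨b, hb, rfl⟩) | ⟨b, hb, hi⟩
          · exact ⟨by simp, l, a, le_rfl, le_rfl, by simp, subset_rfl, mem_cone_self _ _ _, hrob⟩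
          · exact ⟨by simp only; omega, l, a, le_rfl, by simp, le_rfl, hcA b (hBA b hb),
              mem_cone_self _ _ _, hrob⟩
          · exact (hF' b (hBA b hb)).2 i hi
    · exact covered B (by omega) hBA hB'

end Dominated

end SimpleGraph

/-! ### Energies, Gromov products and shadows -/

namespace SimpleGraph

/-- `E` bounds the sum of the squared masses of all cones around `x`. -/
def EnergyLE {V : Type*} (X : SimpleGraph V) (x : V) (f : V →₀ ℂ) (E : ℝ) : Prop :=
  ∀ F : Finset (ℕ × Set V), (∀ i ∈ F, X.IsCone x i) → ∑ i ∈ F, ‖mass f i.2‖ ^ 2 ≤ E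

/-- The Gromov product of `x'` and `y` with respect to `x` is at least `j`. -/
def Fellow {V : Type*} (X : SimpleGraph V) (x x' : V) (j : ℕ) (y : V) : Prop :=
  X.dist x' y + 2 * j ≤ X.dist x x' + X.dist x y

open Classical in
/-- A vertex at distance `l` from `x` on geodesics from `x` to all vertices of `A`. -/
noncomputable def passage {V : Type*} (X : SimpleGraph V) (x : V) (l : ℕ) (A : Set V) : V :=
  if h : ∃ v, X.dist x v = l ∧ ∀ y ∈ A, X.Btw x v y then h.choose else x

section Energy

variable {V : Type*} {X : SimpleGraph V} {x x' : V} {f : V →₀ ℂ} {E : ℝ}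

theorem EnergyLE.nonneg (h : X.EnergyLE x f E) : 0 ≤ E := by
  simpa using h ∅ (by simp)

theorem EnergyLE.norm_mass_le (h : X.EnergyLE x f E) {i : ℕ × Set V} (hi : X.IsCone x i) :
    ‖mass f i.2‖ ≤ √E := by
  refine Real.le_sqrt_of_sq_le ?_
  simpa using h {i} (by simpa using hi)

theorem Dominated.le_sqrt {φ : (V →₀ ℂ) → ℝ} {F : Finset (ℕ × Set V)} {M : ℕ}
    (hφ : X.Dominated x φ F M) (h : X.EnergyLE x f E) : φ f ≤ M ^ 2 * √E := by
  refine (hφ.le f).trans ?_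
  have h1 : ∑ i ∈ F, ‖mass f i.2‖ ≤ ∑ i ∈ F, √E :=
    Finset.sum_le_sum fun i hi => h.norm_mass_le (hφ.isCone i hi)
  rw [Finset.sum_const, nsmul_eq_mul] at h1
  have h2 : (F.card : ℝ) * √E ≤ M * √E :=
    mul_le_mul_of_nonneg_right (by exact_mod_cast hφ.card_le) (Real.sqrt_nonneg _)
  calc (M : ℝ) * ∑ i ∈ F, ‖mass f i.2‖ ≤ M * (M * √E) :=
        mul_le_mul_of_nonneg_left (h1.trans h2) (Nat.cast_nonneg _)
    _ = _ := by ring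

theorem Dominated.sq_le {φ : (V →₀ ℂ) → ℝ} {F : Finset (ℕ × Set V)} {M : ℕ}
    (hφ : X.Dominated x φ F M) (h0 : 0 ≤ φ f) :
    φ f ^ 2 ≤ M ^ 3 * ∑ i ∈ F, ‖mass f i.2‖ ^ 2 := by
  have h1 : φ f ^ 2 ≤ (M * ∑ i ∈ F, ‖mass f i.2‖) ^ 2 := pow_le_pow_left₀ h0 (hφ.le f) 2
  have h2 := sq_sum_le_card_mul F (fun i => ‖mass f i.2‖) hφ.card_le
  calc φ f ^ 2 ≤ M ^ 2 * (∑ i ∈ F, ‖mass f i.2‖) ^ 2 := by rwa [mul_pow] at h1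
    _ ≤ M ^ 2 * (M * ∑ i ∈ F, ‖mass f i.2‖ ^ 2) := mul_le_mul_of_nonneg_left h2 (by positivity)
    _ = _ := by ring

theorem passage_spec (hc : X.Connected) {l : ℕ} {a : V} (h : l ≤ X.dist x a) :
    X.dist x (X.passage x l (X.cone x l a)) = l ∧
      ∀ y ∈ X.cone x l a, X.Btw x (X.passage x l (X.cone x l a)) y := by
  have hex : ∃ v, X.dist x v = l ∧ ∀ y ∈ X.cone x l a, X.Btw x v y := by
    obtain ⟨v, hv, hvl⟩ := exists_btw_dist_eq hc h
    exact ⟨v, hvl, fun y hy => hv.of_mem_cone hvl.le hy⟩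
  unfold passage
  rw [dif_pos hex]
  exact hex.choose_spec

theorem Fellow.le_dist (hc : X.Connected) {j : ℕ} {y : V} (h : X.Fellow x x' j y) :
    j ≤ X.dist x y := by
  have := hc.dist_triangle (u := x) (v := y) (w := x')
  have := X.dist_comm (u := y) (v := x')
  unfold Fellow at h
  omega

theorem Fellow.le_dist' (hc : X.Connected) {j : ℕ} {y : V} (h : X.Fellow x x' j y) :
    j ≤ X.dist x x' := by
  have := hc.dist_triangle (u := x) (v := x') (w := y)
  unfold Fellow at h
  omega

theorem Fellow.mono {j k : ℕ} {y : V} (h : X.Fellow x x' k y) (hjk : j ≤ k) :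
    X.Fellow x x' j y := by
  unfold Fellow at *
  omega

/-- The Gromov products of `x'` and `y` at `x` and of `x` and `y` at `x'` add up to `d(x, x')`. -/
theorem fellow_or_fellow {j : ℕ} (hj : j ≤ X.dist x x') (y : V) :
    X.Fellow x x' j y ∨ X.Fellow x' x (X.dist x x' - j) y := by
  have := X.dist_comm (u := x) (v := x')
  unfold Fellow
  omega

theorem Robust.congr {K m : ℕ} {b c : V} {S : Set V} (h : X.Robust K x m b S)
    (hc : X.cone x m b = X.cone x m c) : X.Robust K x m c S := by
  unfold Robust at *
  rwa [← hc]

/-- Cones that do not look in the direction of `x'` are dominated by nearby cones around `x'`. -/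
theorem exists_dominated_of_not_fellow (hc : X.Connected) {κ : ℕ} (hT : X.ThinWalks κ)
    (hF : X.FourPoint κ) {M : ℕ → ℕ} (hM : X.FineBound M) : ∃ K N J C, ∀ (x x' p y₀ : V),
      X.Btw x p y₀ →
      (∀ y ∈ X.cone x (X.dist x p) y₀, ¬ X.Fellow x x' (X.dist x p + (2 * κ + 1)) y) →
      ∃ F, X.Dominated x' (fun f => ‖mass f (X.cone x (X.dist x p) y₀)‖) F N ∧
        ∀ i ∈ F, ∃ m l, m ≤ i.1 ∧ i.1 ≤ m + 1 ∧ l ≤ m ∧ m ≤ l + J ∧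
          ∀ y ∈ i.2, X.Robust K x' m y (X.cone x (X.dist x p) y₀) ∧
            X.dist x p ≤ X.dist x (X.passage x' l (X.cone x' l y)) + C ∧
            X.dist x (X.passage x' l (X.cone x' l y)) ≤ X.dist x p + C := by
  classical
  obtain ⟨K, hK⟩ := exists_dominated_inter hc hT hF hM
  obtain ⟨M₂, hM₂⟩ := exists_cone_cover_fellow hc hT hF hM
  obtain ⟨N, hN⟩ := hK (8 * κ + 3)
  refine ⟨K, M₂ * N, 8 * κ + 3, 6 * κ + 2, fun x x' p y₀ hp hno => ?_⟩
  set S := X.cone x (X.dist x p) y₀ with hS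
  -- As no `y ∈ S` looks towards `x'`, geodesics from `x'` to `y` follow one to `p` until close to
  -- `p`: the Gromov product of `p` and `y` at `x'` is at least `k`.
  set k := X.dist x' p - (3 * κ + 1) with hk
  have hSk : ∀ y ∈ S, X.dist p y + 2 * k ≤ X.dist x' p + X.dist x' y := by
    intro y hy
    have h1 := hno y hy
    have h2 := hp.of_mem_cone le_rfl hy
    have h3 := hF x y x' p
    have t := hc.dist_triangle (u := p) (v := x') (w := y)
    have c1 := X.dist_comm (u := p) (v := x')
    have c2 := X.dist_comm (u := y) (v := p)
    have c3 := X.dist_comm (u := y) (v := x')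
    unfold Fellow at h1
    unfold Btw at h2
    omega
  obtain ⟨B, hB, hBf, hB'⟩ := hM₂ x' p k
  set l := k - (2 * κ + 1) with hl
  have hla : ∀ a ∈ B, l ≤ X.dist x' a := by
    intro a ha
    have h1 := hBf a ha
    have t := hc.dist_triangle (u := x') (v := a) (w := p)
    have c1 := X.dist_comm (u := a) (v := p)
    omega
  have hFa : ∀ a, ∃ F, a ∈ B → X.Dominated x' (fun f => ‖mass f (S ∩ X.cone x' l a)‖) F N ∧
      ∀ i ∈ F, i.1 ≤ l + (8 * κ + 3) ∧ X.Anchored K x' l a S i := by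
    intro a
    by_cases ha : a ∈ B
    · obtain ⟨F, hF⟩ := hN x p y₀ hp x' l a (by omega) (by have := hla a ha; omega)
      exact ⟨F, fun _ => hF⟩
    · exact ⟨∅, fun h => absurd h ha⟩
  choose F hF' using hFa
  refine ⟨B.biUnion F, (Dominated.sum B hB fun a ha => (hF' a ha).1).mono (fun f => ?_) le_rfl, ?_⟩
  · exact norm_mass_le_sum f B (fun a => X.cone x' l a) (fun b _ c _ y hy hy' => cone_eq_or hy hy')
      fun y hy => hB' y (hSk y hy)
  · intro i hi
    obtain ⟨a, ha, hi⟩ := Finset.mem_biUnion.1 hi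
    obtain ⟨hil, m, b, h1, h2, h3, h4, h5, h6⟩ := (hF' a ha).2 i hi
    refine ⟨m, l, h2, h3, h1, by omega, fun y hy => ⟨h6.congr (cone_eq_of_mem (h4 hy)).symm, ?_⟩⟩
    have hyl : X.cone x' l y = X.cone x' l a := by
      rw [cone_eq_of_mem (cone_anti h1 (h4 hy)), cone_eq_of_mem h5]
    rw [hyl]
    obtain ⟨hv, hv'⟩ := passage_spec hc (hla a ha)
    have hva := hv' a (mem_cone_self _ _ _)
    -- This vertex depends only on the cone around `x'`. It is within `6κ + 2` of `p`, hence
    -- recovers the level `d(x, p)` up to that error.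
    set v := X.passage x' l (X.cone x' l a)
    have h7 := hF x' a v p
    have h8 := hBf a ha
    have t1 := hc.dist_triangle (u := x) (v := v) (w := p)
    have t2 := hc.dist_triangle (u := x) (v := p) (w := v)
    have t3 := hc.dist_triangle (u := x') (v := a) (w := p)
    have c1 := X.dist_comm (u := v) (v := p)
    have c2 := X.dist_comm (u := a) (v := p)
    have c3 := X.dist_comm (u := a) (v := v)
    unfold Btw at hva
    omega

/-- Cones around `x` and `x'` at nearby places on a geodesic from `x` to `x'`. -/
theorem exists_dominated_of_fellow (hc : X.Connected) {κ : ℕ} (hT : X.ThinWalks κ)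
    (hF : X.FourPoint κ) {M : ℕ → ℕ} (hM : X.FineBound M) : ∃ N, ∀ (x x' : V) (j j' : ℕ) (a b : V),
      X.Fellow x x' j a → j' ≤ j + 1 → X.Fellow x' x (X.dist x x' - j') b →
      ∃ F, X.Dominated x' (fun f => ‖mass f (X.cone x (j - (2 * κ + 1)) a ∩
          X.cone x' (X.dist x x' - j' - (2 * κ + 1)) b)‖) F N ∧
        ∀ i ∈ F, X.dist x x' - j' - (2 * κ + 1) ≤ i.1 ∧
          i.1 ≤ X.dist x x' - j' - (2 * κ + 1) + (8 * κ + 4) := by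
  obtain ⟨K, hK⟩ := exists_dominated_inter hc hT hF hM
  obtain ⟨N, hN⟩ := hK (8 * κ + 4)
  refine ⟨N, fun x x' j j' a b ha hj hb => ?_⟩
  have hja := ha.le_dist hc
  have hjx := ha.le_dist' hc
  have hjb := hb.le_dist hc
  obtain ⟨p, hp, hpj⟩ := exists_btw_dist_eq hc (x := x) (y := a) (n := j - (2 * κ + 1)) (by omega)
  have h1 := hF x a p x'
  have c1 := X.dist_comm (u := p) (v := x')
  have c2 := X.dist_comm (u := a) (v := x')
  have c3 := X.dist_comm (u := a) (v := p)
  -- As `p` is almost on a geodesic to `x'`, its distance to `x'` is at most `D - (j - (2κ + 1)) +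
  -- κ`. With `3κ + 1` added and `j' = j + 1` allowed, this makes the offset `8κ + 4`.
  obtain ⟨F, hF₁, hF₂⟩ := hN x p a hp x' (X.dist x x' - j' - (2 * κ + 1)) b (by
    unfold Fellow at ha
    unfold Btw at hp
    omega) (by omega)
  rw [hpj] at hF₁
  refine ⟨F, hF₁, fun i hi => ⟨?_, (hF₂ i hi).1⟩⟩
  obtain ⟨m, c, h2, h3, -⟩ := (hF₂ i hi).2
  omega

/-- The union of the cones of level `j - C` that contain a vertex whose Gromov product with `x'` is
at least `j`. -/
def shadow (X : SimpleGraph V) (C : ℕ) (x x' : V) (j : ℕ) : Set V :=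
  {y | ∃ a, X.Fellow x x' j a ∧ y ∈ X.cone x (j - C) a}

theorem shadow_anti {C j : ℕ} : X.shadow C x x' (j + 1) ⊆ X.shadow C x x' j := by
  rintro y ⟨a, ha, hy⟩
  exact ⟨a, ha.mono (Nat.le_succ j), cone_anti (by omega) hy⟩

/-- The part of a set outside a shadow of `x'` is dominated by cones around `x'` if the intersections
of this set with suitable cones are. -/
theorem exists_dominated_diff_shadow (hc : X.Connected) {κ : ℕ} (hT : X.ThinWalks κ)
    (hF : X.FourPoint κ) {M : ℕ → ℕ} (hM : X.FineBound M) : ∃ K N, ∀ (x x' : V) (j : ℕ) (T : Set V)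
      (N' : ℕ), j ≤ X.dist x x' →
      (∀ a, X.Fellow x x' j a → X.cone x (j - (2 * κ + 1)) a ⊆ T ∨
        Disjoint (X.cone x (j - (2 * κ + 1)) a) T) →
      (∀ b, X.Fellow x' x (X.dist x x' - j) b → ∃ F, X.Dominated x' (fun f => ‖mass f
          (T ∩ X.cone x' (X.dist x x' - j - (2 * κ + 1)) b)‖) F N' ∧
        ∀ i ∈ F, X.dist x x' - j - (2 * κ + 1) ≤ i.1 ∧
          i.1 ≤ X.dist x x' - j - (2 * κ + 1) + (8 * κ + 4)) →
      ∃ F, X.Dominated x' (fun f => ‖mass f (T \ X.shadow (2 * κ + 1) x x' j)‖) F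
          (K * (N' + N)) ∧
        ∀ i ∈ F, X.dist x x' - j - (2 * κ + 1) ≤ i.1 ∧
          i.1 ≤ X.dist x x' - j - (2 * κ + 1) + (8 * κ + 4) := by
  classical
  obtain ⟨M₂, hM₂⟩ := exists_cone_cover_fellow hc hT hF hM
  obtain ⟨N, hN⟩ := exists_dominated_of_fellow hc hT hF hM
  refine ⟨M₂, M₂ * N, fun x x' j T N' hj hTa hTb => ?_⟩
  obtain ⟨A, hA, hAf, hA'⟩ := hM₂ x x' j
  obtain ⟨B, hB, hBf, hB'⟩ := hM₂ x' x (X.dist x x' - j)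
  have cD := X.dist_comm (u := x') (v := x)
  set R := X.shadow (2 * κ + 1) x x' j with hR
  set l := X.dist x x' - j - (2 * κ + 1) with hl
  have hAR : ∀ y ∈ R, ∃ a ∈ A, y ∈ X.cone x (j - (2 * κ + 1)) a := by
    rintro y ⟨a, ha, hy⟩
    obtain ⟨a', ha', haa'⟩ := hA' a ha
    exact ⟨a', ha', cone_eq_of_mem haa' ▸ hy⟩
  have hARs : ∀ a ∈ A, X.cone x (j - (2 * κ + 1)) a ⊆ R := fun a ha y hy => ⟨a, hAf a ha, hy⟩
  -- Inside one cone around `x'`, the mass of `T \ R` is that of `T` minus those of the cones around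
  -- `x` that make up `R` and lie in `T`.
  have hb : ∀ b, ∃ F, b ∈ B → X.Dominated x' (fun f => ‖mass f ((T \ R) ∩ X.cone x' l b)‖) F
      (N' + M₂ * N) ∧ ∀ i ∈ F, l ≤ i.1 ∧ i.1 ≤ l + (8 * κ + 4) := by
    intro b
    by_cases hb : b ∈ B
    swap
    · exact ⟨∅, fun h => absurd h hb⟩
    have hbf : X.Fellow x' x (X.dist x x' - j) b := hBf b hb
    obtain ⟨F₀, hF₀, hF₀'⟩ := hTb b hbf
    have ha : ∀ a, ∃ F, a ∈ A → X.Dominated x' (fun f => ‖mass f (X.cone x (j - (2 * κ + 1)) a ∩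
        X.cone x' l b)‖) F N ∧ ∀ i ∈ F, l ≤ i.1 ∧ i.1 ≤ l + (8 * κ + 4) := by
      intro a
      by_cases ha : a ∈ A
      · obtain ⟨F, hF⟩ := hN x x' j j a b (hAf a ha) (Nat.le_succ j) hbf
        exact ⟨F, fun _ => hF⟩
      · exact ⟨∅, fun h => absurd h ha⟩
    choose F hF' using ha
    refine ⟨F₀ ∪ A.biUnion F, fun _ => ⟨?_, ?_⟩⟩
    · refine (hF₀.add (Dominated.sum A hA fun a ha => (hF' a ha).1)).mono (fun f => ?_) le_rfl
      have e1 : (T \ R) ∩ X.cone x' l b = (T ∩ X.cone x' l b) \ R := by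
        ext y; simp only [Set.mem_inter_iff, Set.mem_sdiff]; tauto
      rw [e1]
      refine (norm_mass_diff_le _ _ _).trans (add_le_add le_rfl ?_)
      refine (norm_mass_le_sum f A (fun a => X.cone x (j - (2 * κ + 1)) a)
        (fun b _ c _ y hy hy' => cone_eq_or hy hy') fun y hy => hAR y hy.2).trans ?_
      refine Finset.sum_le_sum fun a ha => ?_
      rcases hTa a (hAf a ha) with h | h
      · have e2 : T ∩ X.cone x' l b ∩ R ∩ X.cone x (j - (2 * κ + 1)) a =
            X.cone x (j - (2 * κ + 1)) a ∩ X.cone x' l b := by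
          ext y
          have h1 : y ∈ X.cone x (j - (2 * κ + 1)) a → y ∈ T := fun hy => h hy
          have h2 : y ∈ X.cone x (j - (2 * κ + 1)) a → y ∈ R := fun hy => hARs a ha hy
          simp only [Set.mem_inter_iff]
          tauto
        rw [e2]
      · have e2 : T ∩ X.cone x' l b ∩ R ∩ X.cone x (j - (2 * κ + 1)) a = ∅ := by
          ext y
          have h1 : y ∈ X.cone x (j - (2 * κ + 1)) a → y ∉ T :=
            fun hy => Set.disjoint_left.1 h hy
          simp only [Set.mem_inter_iff, Set.mem_empty_iff_false]
          tauto
        rw [e2, mass_empty, norm_zero]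
        exact norm_nonneg _
    · intro i hi
      simp only [Finset.mem_union, Finset.mem_biUnion] at hi
      rcases hi with hi | ⟨a, ha, hi⟩
      · exact hF₀' i hi
      · exact (hF' a ha).2 i hi
  choose F hF' using hb
  refine ⟨B.biUnion F, (Dominated.sum B hB fun b hb => (hF' b hb).1).mono (fun f => ?_) le_rfl, ?_⟩
  · refine norm_mass_le_sum f B (fun b => X.cone x' l b)
      (fun b _ c _ y hy hy' => cone_eq_or hy hy') fun y hy => ?_
    rcases fellow_or_fellow hj y with h | h
    · exact absurd ⟨y, h, mem_cone_self _ _ _⟩ hy.2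
    · exact hB' y h
  · intro i hi
    obtain ⟨b, hb, hi⟩ := Finset.mem_biUnion.1 hi
    exact (hF' b hb).2 i hi

/-- Cones around `x` that look in the direction of `x'`. -/
theorem exists_norm_mass_le_of_fellow (hc : X.Connected) {κ : ℕ} (hT : X.ThinWalks κ)
    (hF : X.FourPoint κ) {M : ℕ → ℕ} (hM : X.FineBound M) : ∃ K : ℕ, ∀ (x x' : V) (n : ℕ) (y₀ : V),
      X.Fellow x x' (n + (2 * κ + 1)) y₀ → ∀ f E, X.EnergyLE x' f E →
      ‖mass f (X.cone x n y₀)‖ ≤ K * (X.dist x x' + 1) * √E := by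
  classical
  obtain ⟨M₂, hM₂⟩ := exists_cone_cover_fellow hc hT hF hM
  obtain ⟨N, hN⟩ := exists_dominated_of_fellow hc hT hF hM
  obtain ⟨K, N₁, hK⟩ := exists_dominated_diff_shadow hc hT hF hM
  set Q := K * (N + N₁) with hQ
  refine ⟨M₂ * (N ^ 2 + Q ^ 2), fun x x' n y₀ hy₀ f E hE => ?_⟩
  set S := X.cone x n y₀ with hS
  set D := X.dist x x' with hD
  set R := fun j => X.shadow (2 * κ + 1) x x' j with hR
  have hs := Real.sqrt_nonneg E
  have sub : ∀ j, n + (2 * κ + 1) ≤ j → ∀ a, X.cone x (j - (2 * κ + 1)) a ⊆ S ∨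
      Disjoint (X.cone x (j - (2 * κ + 1)) a) S := by
    intro j hj a
    by_cases h : Disjoint (X.cone x (j - (2 * κ + 1)) a) S
    · exact Or.inr h
    · obtain ⟨y, hy, hyS⟩ := Set.not_disjoint_iff.1 h
      exact Or.inl (cone_subset_of_mem (by omega) hy hyS)
  have split : ∀ j, n + (2 * κ + 1) ≤ j → ∀ (T : Set V) (q : ℝ), 0 ≤ q →
      (∀ a, X.Fellow x x' j a → ‖mass f (X.cone x (j - (2 * κ + 1)) a \ T)‖ ≤ q) →
      ‖mass f ((S ∩ R j) \ T)‖ ≤ M₂ * q := by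
    intro j hj T q hq h
    obtain ⟨A, hA, hAf, hA'⟩ := hM₂ x x' j
    refine (norm_mass_le_sum f A (fun a => X.cone x (j - (2 * κ + 1)) a)
      (fun b _ c _ y hy hy' => cone_eq_or hy hy') ?_).trans ?_
    · rintro y ⟨⟨-, a, ha, hy⟩, -⟩
      obtain ⟨a', ha', haa'⟩ := hA' a ha
      exact ⟨a', ha', cone_eq_of_mem haa' ▸ hy⟩
    · calc _ ≤ ∑ a ∈ A, q := by
            refine Finset.sum_le_sum fun a ha => ?_
            rcases sub j hj a with h1 | h1
            · have e : (S ∩ R j) \ T ∩ X.cone x (j - (2 * κ + 1)) a =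
                  X.cone x (j - (2 * κ + 1)) a \ T := by
                ext y
                have h2 : y ∈ X.cone x (j - (2 * κ + 1)) a → y ∈ S := fun hy => h1 hy
                have h3 : y ∈ X.cone x (j - (2 * κ + 1)) a → y ∈ R j :=
                  fun hy => ⟨a, hAf a ha, hy⟩
                simp only [Set.mem_inter_iff, Set.mem_sdiff]
                tauto
              rw [e]
              exact h a (hAf a ha)
            · have e : (S ∩ R j) \ T ∩ X.cone x (j - (2 * κ + 1)) a = ∅ := by
                ext y
                have h2 : y ∈ X.cone x (j - (2 * κ + 1)) a → y ∉ S :=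
                  fun hy => Set.disjoint_left.1 h1 hy
                simp only [Set.mem_inter_iff, Set.mem_sdiff, Set.mem_empty_iff_false]
                tauto
              rw [e, mass_empty, norm_zero]
              exact hq
        _ = A.card * q := by rw [Finset.sum_const, nsmul_eq_mul]
        _ ≤ M₂ * q := mul_le_mul_of_nonneg_right (by exact_mod_cast hA) hq
  have step : ∀ j, n + (2 * κ + 1) ≤ j → j + 1 ≤ D →
      ‖mass f ((S ∩ R j) \ R (j + 1))‖ ≤ M₂ * (Q ^ 2 * √E) := by
    intro j hj hjD
    refine split j hj _ _ (by positivity) fun a ha => ?_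
    obtain ⟨F, hF, -⟩ := hK x x' (j + 1) (X.cone x (j - (2 * κ + 1)) a) N hjD (fun c _ => by
      by_cases h : Disjoint (X.cone x (j + 1 - (2 * κ + 1)) c) (X.cone x (j - (2 * κ + 1)) a)
      · exact Or.inr h
      · obtain ⟨y, hy, hyS⟩ := Set.not_disjoint_iff.1 h
        exact Or.inl (cone_subset_of_mem (by omega) hy hyS))
      (fun b hb => hN x x' j (j + 1) a b ha le_rfl hb)
    have := hF.le_sqrt hE
    exact_mod_cast this
  have last : n + (2 * κ + 1) ≤ D → ‖mass f (S ∩ R D)‖ ≤ M₂ * (N ^ 2 * √E) := by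
    intro hn
    have := split D hn ∅ (N ^ 2 * √E) (by positivity) fun a ha => ?_
    · simpa using this
    · obtain ⟨F, hF, -⟩ := hN x x' D D a x' ha (Nat.le_succ D) (by
        have := X.dist_comm (u := x) (v := x')
        unfold Fellow
        omega)
      have := hF.le_sqrt hE
      rw [show X.dist x x' - D - (2 * κ + 1) = 0 by omega, cone_zero hc, Set.inter_univ] at this
      simpa using this
  -- Telescoping along the decreasing sets `S ∩ R j`: each slice and the final piece have mass
  -- `O(√E)`, and there are at most `D` slices.
  have ind : ∀ k, n + (2 * κ + 1) + k ≤ D → ‖mass f S‖ ≤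
      ‖mass f (S ∩ R (n + (2 * κ + 1) + k))‖ + k * (M₂ * (Q ^ 2 * √E)) := by
    intro k
    induction k with
    | zero =>
      intro _
      have : S ⊆ R (n + (2 * κ + 1)) := fun y hy => ⟨y₀, hy₀, by simpa using hy⟩
      rw [Nat.add_zero, Set.inter_eq_left.2 this]
      simp
    | succ k ih =>
      intro hk
      have h1 := ih (by omega)
      have h2 := step (n + (2 * κ + 1) + k) (by omega) (by omega)
      have h3 := norm_mass_le_add f (S ∩ R (n + (2 * κ + 1) + k)) (R (n + (2 * κ + 1) + k + 1))
      have h4 : S ∩ R (n + (2 * κ + 1) + k) ∩ R (n + (2 * κ + 1) + k + 1) =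
          S ∩ R (n + (2 * κ + 1) + k + 1) := by
        rw [Set.inter_assoc, Set.inter_eq_right.2 shadow_anti]
      rw [h4] at h3
      rw [← Nat.add_assoc]
      push_cast
      linarith
  have hnD : n + (2 * κ + 1) ≤ D := hy₀.le_dist' hc
  have h1 := ind (D - (n + (2 * κ + 1))) (by omega)
  rw [show n + (2 * κ + 1) + (D - (n + (2 * κ + 1))) = D by omega] at h1
  have h2 := last hnD
  have h3 : ((D - (n + (2 * κ + 1)) : ℕ) : ℝ) * (M₂ * (Q ^ 2 * √E)) ≤
      D * (M₂ * (Q ^ 2 * √E)) :=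
    mul_le_mul_of_nonneg_right (by exact_mod_cast Nat.sub_le _ _) (by positivity)
  have h4 : 0 ≤ (M₂ : ℝ) * (Q ^ 2 * √E) := by positivity
  have h5 : 0 ≤ (D : ℝ) * (M₂ * (N ^ 2 * √E)) := by positivity
  push_cast
  nlinarith

end Energy

end SimpleGraph

/-! ### Change of the base point -/

namespace SimpleGraph

section Change

variable {V : Type*} {X : SimpleGraph V} {x x' : V} {f : V →₀ ℂ} {E : ℝ}

/-- Singletons are cones around every vertex, only at different levels, so their masses already
occur in the energy at `x'`. -/
theorem EnergyLE.sum_singleton_le (hc : X.Connected) (h : X.EnergyLE x' f E)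
    (T : Finset (ℕ × Set V)) (hT : ∀ i ∈ T, ∃ y, i = (X.dist x y + 1, {y})) :
    ∑ i ∈ T, ‖mass f i.2‖ ^ 2 ≤ E := by
  classical
  have hT' : ∀ i, ∃ y, i ∈ T → i = (X.dist x y + 1, {y}) := by
    intro i
    by_cases hi : i ∈ T
    · obtain ⟨y, hy⟩ := hT i hi
      exact ⟨y, fun _ => hy⟩
    · exact ⟨x, fun h => absurd h hi⟩
  choose y hy using hT'
  have hinj : Set.InjOn (fun i => (X.dist x' (y i) + 1, ({y i} : Set V))) T := by
    intro i hi j hj hij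
    have h1 : y i = y j := Set.singleton_injective (congrArg Prod.snd hij)
    rw [hy i hi, hy j hj, h1]
  have h1 := h (T.image fun i => (X.dist x' (y i) + 1, ({y i} : Set V))) (by
    intro i hi
    obtain ⟨j, hj, rfl⟩ := Finset.mem_image.1 hi
    exact ⟨y j, le_rfl, (cone_eq_singleton hc (Nat.lt_succ_self _)).symm⟩)
  rw [Finset.sum_image hinj] at h1
  refine le_trans (le_of_eq (Finset.sum_congr rfl fun i hi => ?_)) h1
  have h2 : i.2 = {y i} := congrArg Prod.snd (hy i hi)
  simp only [h2]

/-- It suffices that a cone `j` around `x'` serves boundedly many cones `i` around `x`. The offsets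
of `m` from the level of `j`, of `l` from `m`, and of the level of `i` from the distance between `x`
and the passage vertex are bounded. They determine the level of `i`, and `Robust.eq_of_cone` then
determines its set. -/
theorem exists_sum_le_of_not_fellow (hc : X.Connected) {κ : ℕ} (hT : X.ThinWalks κ)
    (hF : X.FourPoint κ) {M : ℕ → ℕ} (hM : X.FineBound M) : ∃ K : ℕ, ∀ (x x' : V) (f : V →₀ ℂ)
      (E : ℝ), X.EnergyLE x' f E → ∀ T : Finset (ℕ × Set V),
      (∀ i ∈ T, ∃ p y₀, X.Btw x p y₀ ∧ i = (X.dist x p, X.cone x (X.dist x p) y₀) ∧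
        ∀ y ∈ i.2, ¬ X.Fellow x x' (i.1 + (2 * κ + 1)) y) →
      ∑ i ∈ T, ‖mass f i.2‖ ^ 2 ≤ K * E := by
  classical
  obtain ⟨K, N, J, C, hK⟩ := exists_dominated_of_not_fellow hc hT hF hM
  refine ⟨N ^ 3 * (2 * ((J + 1) * (2 * C + 1))), fun x x' f E hE T hTT => ?_⟩
  have hF : ∀ i, ∃ F, i ∈ T → X.Dominated x' (fun f => ‖mass f i.2‖) F N ∧
      ∀ j ∈ F, ∃ m l, m ≤ j.1 ∧ j.1 ≤ m + 1 ∧ l ≤ m ∧ m ≤ l + J ∧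
          ∀ y ∈ j.2, X.Robust K x' m y i.2 ∧
            i.1 ≤ X.dist x (X.passage x' l (X.cone x' l y)) + C ∧
            X.dist x (X.passage x' l (X.cone x' l y)) ≤ i.1 + C := by
    intro i
    by_cases hi : i ∈ T
    · obtain ⟨p, y₀, hp, rfl, h⟩ := hTT i hi
      obtain ⟨F, hF⟩ := hK x x' p y₀ hp h
      exact ⟨F, fun _ => hF⟩
    · exact ⟨∅, fun h => absurd h hi⟩
  choose F hF using hF
  have h1 : ∑ i ∈ T, ‖mass f i.2‖ ^ 2 ≤ ∑ i ∈ T, (N : ℝ) ^ 3 * ∑ j ∈ F i, ‖mass f j.2‖ ^ 2 :=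
    Finset.sum_le_sum fun i hi => (hF i hi).1.sq_le (norm_nonneg _)
  have h2 := sum_sum_le_of_card_le T F (fun j => ‖mass f j.2‖ ^ 2) (fun _ => sq_nonneg _)
    (m := 2 * ((J + 1) * (2 * C + 1))) (by
      intro j T' hT' hj
      rcases T'.eq_empty_or_nonempty with rfl | ⟨t₀, ht₀⟩
      · simp
      obtain ⟨y, -, hy⟩ := (hF t₀ (hT' ht₀)).1.isCone j (hj t₀ ht₀)
      have hyj : y ∈ j.2 := hy ▸ mem_cone_self _ _ _
      have hml : ∀ t, ∃ m l, t ∈ T' → m ≤ j.1 ∧ j.1 ≤ m + 1 ∧ l ≤ m ∧ m ≤ l + J ∧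
          X.Robust K x' m y t.2 ∧ t.1 ≤ X.dist x (X.passage x' l (X.cone x' l y)) + C ∧
            X.dist x (X.passage x' l (X.cone x' l y)) ≤ t.1 + C := by
        intro t
        by_cases ht : t ∈ T'
        · obtain ⟨m, l, h1, h2, h3, h4, h5⟩ := (hF t (hT' ht)).2 j (hj t ht)
          exact ⟨m, l, fun _ => ⟨h1, h2, h3, h4, h5 y hyj⟩⟩
        · exact ⟨0, 0, fun h => absurd h ht⟩
      choose m l hml using hml
      have hcard : (Finset.range 2 ×ˢ (Finset.range (J + 1) ×ˢ Finset.range (2 * C + 1))).card =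
          2 * ((J + 1) * (2 * C + 1)) := by
        simp only [Finset.card_product, Finset.card_range]
      rw [← hcard]
      refine Finset.card_le_card_of_injOn (fun t => (j.1 - m t, m t - l t,
        t.1 + C - X.dist x (X.passage x' (l t) (X.cone x' (l t) y)))) ?_ ?_
      · intro t ht
        obtain ⟨h1, h2, h3, h4, -, h6, h7⟩ := hml t ht
        simp only [Finset.coe_product, Set.mem_prod, Finset.mem_coe, Finset.mem_range]
        omega
      · intro t ht s hs hts
        obtain ⟨h1, h2, h3, h4, h5, h6, h7⟩ := hml t ht
        obtain ⟨g1, g2, g3, g4, g5, g6, g7⟩ := hml s hs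
        simp only [Prod.mk.injEq] at hts
        obtain ⟨e1, e2, e3⟩ := hts
        have em : m t = m s := by omega
        have el : l t = l s := by omega
        rw [el] at h6 h7 e3
        have e0 : t.1 = s.1 := by omega
        rw [em] at h5
        obtain ⟨p, y₁, -, ht', -⟩ := hTT t (hT' ht)
        obtain ⟨p', y₂, -, hs', -⟩ := hTT s (hT' hs)
        have q1 : t.2 = X.cone x s.1 y₁ := by
          rw [← e0, show t.1 = X.dist x p from congrArg Prod.fst ht']
          exact congrArg Prod.snd ht'
        have q2 : s.2 = X.cone x s.1 y₂ := by
          conv_rhs => rw [show s.1 = X.dist x p' from congrArg Prod.fst hs']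
          exact congrArg Prod.snd hs'
        rw [q1] at h5
        rw [q2] at g5
        exact Prod.ext e0 (by rw [q1, q2, h5.eq_of_cone g5]))
  rw [← Finset.mul_sum] at h1
  have h3 := hE (T.biUnion F) (by
    intro j hj
    obtain ⟨i, hi, hj⟩ := Finset.mem_biUnion.1 hj
    exact (hF i hi).1.isCone j hj)
  refine h1.trans ?_
  calc (N : ℝ) ^ 3 * ∑ i ∈ T, ∑ j ∈ F i, ‖mass f j.2‖ ^ 2
      ≤ N ^ 3 * ((2 * ((J + 1) * (2 * C + 1)) : ℕ) * E) := by
        refine mul_le_mul_of_nonneg_left (h2.trans ?_) (by positivity)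
        exact mul_le_mul_of_nonneg_left h3 (Nat.cast_nonneg _)
    _ = _ := by push_cast; ring

/-- At most `D + 1` levels contain such cones, boundedly many each, and each squared mass is `O((D +
1)² E)`. -/
theorem exists_sum_le_of_fellow (hc : X.Connected) {κ : ℕ} (hT : X.ThinWalks κ)
    (hF : X.FourPoint κ) {M : ℕ → ℕ} (hM : X.FineBound M) : ∃ K : ℕ, ∀ (x x' : V) (f : V →₀ ℂ)
      (E : ℝ), X.EnergyLE x' f E → ∀ T : Finset (ℕ × Set V),
      (∀ i ∈ T, ∃ y, X.Fellow x x' (i.1 + (2 * κ + 1)) y ∧ i.2 = X.cone x i.1 y) →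
      ∑ i ∈ T, ‖mass f i.2‖ ^ 2 ≤ K * (X.dist x x' + 1) ^ 3 * E := by
  classical
  obtain ⟨K, hK⟩ := exists_norm_mass_le_of_fellow hc hT hF hM
  obtain ⟨M₂, hM₂⟩ := exists_cone_cover_fellow hc hT hF hM
  refine ⟨M₂ * K ^ 2, fun x x' f E hE T hTT => ?_⟩
  have hE0 := hE.nonneg
  set D := X.dist x x' with hD
  choose A hA hAf hA' using fun n => hM₂ x x' (n + (2 * κ + 1))
  have hcard : T.card ≤ (D + 1) * M₂ := by
    have hsub : T ⊆ (Finset.range (D + 1)).biUnion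
        fun n => (A n).image fun a => (n, X.cone x n a) := by
      intro i hi
      obtain ⟨y, hy, hi'⟩ := hTT i hi
      obtain ⟨a, ha, hya⟩ := hA' i.1 y hy
      rw [Nat.add_sub_cancel] at hya
      refine Finset.mem_biUnion.2 ⟨i.1, ?_, Finset.mem_image.2 ⟨a, ha, ?_⟩⟩
      · have := hy.le_dist' hc
        rw [Finset.mem_range]
        omega
      · rw [← cone_eq_of_mem hya, ← hi']
    refine (Finset.card_le_card hsub).trans ?_
    have := Finset.card_biUnion_le_card_mul (Finset.range (D + 1))
      (fun n => (A n).image fun a => (n, X.cone x n a)) M₂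
      fun n _ => Finset.card_image_le.trans (hA n)
    rwa [Finset.card_range] at this
  have hterm : ∀ i ∈ T, ‖mass f i.2‖ ^ 2 ≤ (K * (D + 1)) ^ 2 * E := by
    intro i hi
    obtain ⟨y, hy, hi'⟩ := hTT i hi
    have h1 := hK x x' i.1 y hy f E hE
    rw [← hi'] at h1
    have h2 := pow_le_pow_left₀ (norm_nonneg _) h1 2
    rwa [mul_pow, Real.sq_sqrt hE0] at h2
  calc ∑ i ∈ T, ‖mass f i.2‖ ^ 2 ≤ T.card • ((K * (D + 1)) ^ 2 * E) :=
        Finset.sum_le_card_nsmul _ _ _ hterm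
    _ = T.card * ((K * (D + 1)) ^ 2 * E) := by rw [nsmul_eq_mul]
    _ ≤ ((D + 1) * M₂ : ℕ) * ((K * (D + 1)) ^ 2 * E) :=
        mul_le_mul_of_nonneg_right (by exact_mod_cast hcard) (by positivity)
    _ = _ := by push_cast; ring

/-- Moving the base point changes the energy by a factor that is polynomial in the distance. -/
theorem exists_energyLE_change (hc : X.Connected) {κ : ℕ} (hT : X.ThinWalks κ)
    (hF : X.FourPoint κ) {M : ℕ → ℕ} (hM : X.FineBound M) : ∃ K : ℕ, ∀ (x x' : V) (f : V →₀ ℂ)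
      (E : ℝ), X.EnergyLE x' f E → X.EnergyLE x f (K * (X.dist x x' + 1) ^ 3 * E) := by
  classical
  obtain ⟨K₁, hK₁⟩ := exists_sum_le_of_not_fellow hc hT hF hM
  obtain ⟨K₂, hK₂⟩ := exists_sum_le_of_fellow hc hT hF hM
  refine ⟨1 + K₁ + K₂, fun x x' f E hE T hTT => ?_⟩
  have hE0 := hE.nonneg
  -- Three kinds of cones: singletons one level above their vertex, cones with a vertex that looks
  -- towards `x'`, and the others.
  set P : ℕ × Set V → Prop := fun i => ∃ y, i = (X.dist x y + 1, {y}) with hP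
  set Q : ℕ × Set V → Prop := fun i =>
    ∃ y, X.Fellow x x' (i.1 + (2 * κ + 1)) y ∧ i.2 = X.cone x i.1 y with hQ
  rw [← Finset.sum_filter_add_sum_filter_not T P,
    ← Finset.sum_filter_add_sum_filter_not (T.filter fun i => ¬ P i) Q]
  have h1 := hE.sum_singleton_le hc (x := x) (T.filter P) fun i hi => (Finset.mem_filter.1 hi).2
  have h2 := hK₂ x x' f E hE ((T.filter fun i => ¬ P i).filter Q)
    fun i hi => (Finset.mem_filter.1 hi).2
  have h3 := hK₁ x x' f E hE ((T.filter fun i => ¬ P i).filter fun i => ¬ Q i) (by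
    intro i hi
    obtain ⟨hi, hiQ⟩ := Finset.mem_filter.1 hi
    obtain ⟨hi, hiP⟩ := Finset.mem_filter.1 hi
    obtain ⟨y₀, hy₀, hi'⟩ := hTT i hi
    have hle : i.1 ≤ X.dist x y₀ := by
      by_contra hlt
      have he : i.1 = X.dist x y₀ + 1 := by omega
      refine hiP ⟨y₀, Prod.ext he ?_⟩
      rw [hi', he]
      exact cone_eq_singleton hc (Nat.lt_succ_self _)
    obtain ⟨p, hp, hpi⟩ := exists_btw_dist_eq hc hle
    refine ⟨p, y₀, hp, Prod.ext hpi.symm (by rw [hpi, hi']), fun y hy hf => hiQ ⟨y, hf, ?_⟩⟩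
    rw [hi'] at hy
    rw [hi', cone_eq_of_mem hy])
  have h4 : (1 : ℝ) ≤ (X.dist x x' + 1) ^ 3 := one_le_pow₀ (by
    have : (0 : ℝ) ≤ X.dist x x' := Nat.cast_nonneg _
    linarith)
  have h5 : (1 + K₁ : ℝ) * E * 1 ≤ (1 + K₁) * E * (X.dist x x' + 1) ^ 3 :=
    mul_le_mul_of_nonneg_left h4 (by positivity)
  push_cast
  linarith

theorem norm_sq_mass_univ_le (hc : X.Connected) (h : X.EnergyLE x f E) :
    ‖mass f Set.univ‖ ^ 2 ≤ E := by
  have h1 : X.IsCone x (0, Set.univ) := ⟨x, by simp, (cone_zero hc x x).symm⟩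
  simpa using h {(0, Set.univ)} (by simpa using h1)

/-- A function with bounded energies with respect to two remote vertices has small total mass. -/
theorem exists_dist_mul_norm_sq_mass_univ_le (hc : X.Connected) {κ : ℕ} (hT : X.ThinWalks κ)
    (hF : X.FourPoint κ) {M : ℕ → ℕ} (hM : X.FineBound M) : ∃ K : ℕ, ∀ (x x' : V) (f : V →₀ ℂ)
      (E : ℝ), X.EnergyLE x f E → X.EnergyLE x' f E →
      X.dist x x' * ‖mass f Set.univ‖ ^ 2 ≤ K * E := by
  classical
  obtain ⟨M₂, hM₂⟩ := exists_cone_cover_fellow hc hT hF hM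
  obtain ⟨K, N₁, hK⟩ := exists_dominated_diff_shadow hc hT hF hM
  set Q := K * (1 + N₁) with hQ
  set C := 2 * κ + 1 with hC
  set J := 8 * κ + 4 with hJ
  refine ⟨2 * M₂ + 2 * (Q ^ 3 * (J + 1)) + 2 * C, fun x x' f E hE hE' => ?_⟩
  have hE0 := hE.nonneg
  have hu := norm_sq_mass_univ_le hc hE
  set D := X.dist x x' with hD
  set a := ‖mass f Set.univ‖ with ha
  choose A hA hAf hA' using fun j => hM₂ x x' j
  have hF' : ∀ j, ∃ F, j ≤ D → X.Dominated x'
      (fun f => ‖mass f (Set.univ \ X.shadow C x x' j)‖) F Q ∧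
      ∀ i ∈ F, D - j - C ≤ i.1 ∧ i.1 ≤ D - j - C + J := by
    intro j
    by_cases hj : j ≤ D
    · obtain ⟨F, hF⟩ := hK x x' j Set.univ 1 hj (fun a _ => Or.inl (Set.subset_univ _)) (by
        intro b hb
        rw [Set.univ_inter]
        refine ⟨_, IsCone.dominated (i := (D - j - C, X.cone x' (D - j - C) b)) ⟨b, ?_, rfl⟩, ?_⟩
        · have := hb.le_dist hc
          simp only
          omega
        · intro i hi
          rw [Finset.mem_singleton] at hi
          subst hi
          exact ⟨le_rfl, Nat.le_add_right _ _⟩)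
      exact ⟨F, fun _ => hF⟩
    · exact ⟨∅, fun h => absurd h hj⟩
  choose F hF' using hF'
  set G : ℕ → Finset (ℕ × Set V) := fun j => (A j).image fun a => (j - C, X.cone x (j - C) a)
    with hG
  have hGcone : ∀ j, ∀ i ∈ G j, X.IsCone x i := by
    intro j i hi
    obtain ⟨b, hb, rfl⟩ := Finset.mem_image.1 hi
    refine ⟨b, ?_, rfl⟩
    have := (show X.Fellow x x' j b from hAf j b hb).le_dist hc
    simp only
    omega
  -- The shadow of level `j` consists of boundedly many cones around `x`, and its complement is
  -- dominated from `x'`. Away from the ends neither `j - C` nor `D - j - C` truncates, so a cone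
  -- around `x` serves one `j` and a cone around `x'` at most `J + 1`.
  have hsq : ∀ j ∈ Finset.Ico C (D - C), a ^ 2 ≤ 2 * (M₂ * ∑ i ∈ G j, ‖mass f i.2‖ ^ 2) +
      2 * (Q ^ 3 * ∑ i ∈ F j, ‖mass f i.2‖ ^ 2) := by
    intro j hj
    rw [Finset.mem_Ico] at hj
    have h1 := norm_mass_le_add f Set.univ (X.shadow C x x' j)
    rw [Set.univ_inter] at h1
    have h2 : ‖mass f (X.shadow C x x' j)‖ ≤ ∑ i ∈ G j, ‖mass f i.2‖ := by
      refine (norm_mass_le_sum f (G j) Prod.snd ?_ ?_).trans_eq ?_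
      · intro i hi i' hi' y hy hy'
        obtain ⟨b, -, rfl⟩ := Finset.mem_image.1 hi
        obtain ⟨c, -, rfl⟩ := Finset.mem_image.1 hi'
        exact cone_eq_or hy hy'
      · rintro y ⟨b, hb, hy⟩
        obtain ⟨c, hc', hbc⟩ := hA' j b hb
        exact ⟨_, Finset.mem_image_of_mem _ hc', cone_eq_of_mem hbc ▸ hy⟩
      · refine Finset.sum_congr rfl fun i hi => ?_
        obtain ⟨b, hb, rfl⟩ := Finset.mem_image.1 hi
        have hs : X.cone x (j - C) b ⊆ X.shadow C x x' j := fun y hy => ⟨b, hAf j b hb, hy⟩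
        rw [Set.inter_eq_right.2 hs]
    have h3 := pow_le_pow_left₀ (norm_nonneg _) h2 2
    have h4 := sq_sum_le_card_mul (G j) (fun i => ‖mass f i.2‖)
      (Finset.card_image_le.trans (hA j))
    have h5 := (hF' j (by omega)).1.sq_le (f := f) (norm_nonneg _)
    have h6 := pow_le_pow_left₀ (norm_nonneg _) h1 2
    have h7 := add_sq_le (a := ‖mass f (X.shadow C x x' j)‖)
      (b := ‖mass f (Set.univ \ X.shadow C x x' j)‖)
    linarith
  have hsum := Finset.sum_le_sum hsq
  rw [Finset.sum_const, Nat.card_Ico, nsmul_eq_mul, Finset.sum_add_distrib, ← Finset.mul_sum,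
    ← Finset.mul_sum, ← Finset.mul_sum, ← Finset.mul_sum] at hsum
  have hg := sum_sum_le_of_card_le (Finset.Ico C (D - C)) G (fun j => ‖mass f j.2‖ ^ 2)
    (fun _ => sq_nonneg _) (m := 1) (by
      intro i T hT hi
      refine Finset.card_le_one.2 fun s hs t ht => ?_
      obtain ⟨b, -, hb⟩ := Finset.mem_image.1 (hi s hs)
      obtain ⟨c, -, hc'⟩ := Finset.mem_image.1 (hi t ht)
      have e1 : s - C = t - C := congrArg Prod.fst (hb.trans hc'.symm)
      have e2 := Finset.mem_Ico.1 (hT hs)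
      have e3 := Finset.mem_Ico.1 (hT ht)
      omega)
  have hf := sum_sum_le_of_card_le (Finset.Ico C (D - C)) F (fun j => ‖mass f j.2‖ ^ 2)
    (fun _ => sq_nonneg _) (m := J + 1) (by
      intro i T hT hi
      refine (Finset.card_le_card (t := Finset.Icc (D - C - i.1) (D - C - i.1 + J)) ?_).trans ?_
      · intro j hj
        have e1 := Finset.mem_Ico.1 (hT hj)
        have e2 := (hF' j (by omega)).2 i (hi j hj)
        rw [Finset.mem_Icc]
        omega
      · rw [Nat.card_Icc]
        omega)
  have hg' := hE ((Finset.Ico C (D - C)).biUnion G) (by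
    intro i hi
    obtain ⟨j, -, hi⟩ := Finset.mem_biUnion.1 hi
    exact hGcone j i hi)
  have hf' := hE' ((Finset.Ico C (D - C)).biUnion F) (by
    intro i hi
    obtain ⟨j, hj, hi⟩ := Finset.mem_biUnion.1 hi
    exact (hF' j (by have := Finset.mem_Ico.1 hj; omega)).1.isCone i hi)
  have hD2 : (D : ℝ) ≤ ((D - C - C : ℕ) : ℝ) + 2 * C := by
    have : D ≤ D - C - C + 2 * C := by omega
    exact_mod_cast this
  have e1 : (M₂ : ℝ) * ∑ i ∈ Finset.Ico C (D - C), ∑ j ∈ G i, ‖mass f j.2‖ ^ 2 ≤ M₂ * E :=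
    mul_le_mul_of_nonneg_left (hg.trans (by simpa using hg')) (Nat.cast_nonneg _)
  have e2 : (Q : ℝ) ^ 3 * ∑ i ∈ Finset.Ico C (D - C), ∑ j ∈ F i, ‖mass f j.2‖ ^ 2 ≤
      Q ^ 3 * (((J + 1 : ℕ) : ℝ) * E) :=
    mul_le_mul_of_nonneg_left (hf.trans (mul_le_mul_of_nonneg_left hf' (Nat.cast_nonneg _)))
      (by positivity)
  calc (D : ℝ) * a ^ 2 ≤ (((D - C - C : ℕ) : ℝ) + 2 * C) * a ^ 2 :=
        mul_le_mul_of_nonneg_right hD2 (sq_nonneg _)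
    _ = ((D - C - C : ℕ) : ℝ) * a ^ 2 + 2 * C * a ^ 2 := by ring
    _ ≤ (2 * (M₂ * E) + 2 * (Q ^ 3 * (((J + 1 : ℕ) : ℝ) * E))) + 2 * C * E := by
        have := mul_le_mul_of_nonneg_left hu (show (0 : ℝ) ≤ 2 * C by positivity)
        linarith
    _ = _ := by push_cast; ring

end Change

end SimpleGraph

/-! ### Hilbert completions and strong Property (T) -/

section Completion

/-- The Hilbert space completion of a complex vector space with respect to the semi-norm induced by
a linear map into an inner product space. It lives in the universe of the vector space. -/
theorem exists_hilbert_completion {E : Type u} [AddCommGroup E] [Module ℂ E] {N : Type*}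
    [NormedAddCommGroup N] [InnerProductSpace ℂ N] (Φ : E →ₗ[ℂ] N) :
    ∃ (H : Type u) (_ : NormedAddCommGroup H) (_ : InnerProductSpace ℂ H) (_ : CompleteSpace H)
      (e : E →ₗ[ℂ] H), DenseRange e ∧ ∀ v, ‖e v‖ = ‖Φ v‖ := by
  let _ : SeminormedAddCommGroup E := SeminormedAddCommGroup.induced E N Φ
  let _ : InnerProductSpace ℂ E := InnerProductSpace.induced Φ
  refine ⟨UniformSpace.Completion E, inferInstance, inferInstance, inferInstance,
    (UniformSpace.Completion.toComplL (𝕜 := ℂ) (E := E)).toLinearMap, ?_, ?_⟩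
  · exact UniformSpace.Completion.denseRange_coe
  · intro v
    exact UniformSpace.Completion.norm_coe v

end Completion

section SignedIntegral

variable {G : Type*} [TopologicalSpace G] [T2Space G] [MeasurableSpace G] [BorelSpace G]

theorem IsCompactlySupportedMeasure.exists_isCompact {m : SignedMeasure G}
    (hm : IsCompactlySupportedMeasure m) :
    ∃ K : Set G, IsCompact K ∧ m.toJordanDecomposition.posPart Kᶜ = 0 ∧
      m.toJordanDecomposition.negPart Kᶜ = 0 := by
  obtain ⟨K, hK, h⟩ := hm
  have hKm : MeasurableSet Kᶜ := hK.measurableSet.compl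
  obtain ⟨i, hi₁, hi₂, hi₃, hp, hn⟩ := m.toJordanDecomposition_spec
  refine ⟨K, hK, ?_, ?_⟩
  · rw [← measureReal_eq_zero_iff, hp,
      SignedMeasure.toMeasureOfZeroLE_real_apply _ hi₂ hi₁ hKm]
    exact h _ (hi₁.inter hKm) (Set.disjoint_left.2 fun a ha => ha.2)
  · rw [← measureReal_eq_zero_iff, hn,
      SignedMeasure.toMeasureOfLEZero_real_apply _ hi₃ hi₁.compl hKm,
      h _ (hi₁.compl.inter hKm) (Set.disjoint_left.2 fun a ha => ha.2), neg_zero]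

theorem Continuous.integrable_of_measure_compl_eq_zero {F : Type*} [NormedAddCommGroup F]
    {μ : Measure G} [IsFiniteMeasure μ] {f : G → F} (hf : Continuous f) {K : Set G}
    (hK : IsCompact K) (h : μ Kᶜ = 0) : Integrable f μ := by
  have hr : μ.restrict K = μ := Measure.restrict_eq_self_of_ae_mem (mem_ae_iff.2 h)
  obtain ⟨C, hC⟩ := hK.exists_bound_of_continuousOn hf.continuousOn
  have h1 := hf.continuousOn.aestronglyMeasurable_of_isCompact (μ := μ) hK hK.measurableSet
  rw [hr] at h1
  refine Integrable.of_bound h1 C ?_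
  filter_upwards [mem_ae_iff.2 h] with a ha using hC a ha

theorem IsCompactlySupportedMeasure.map_signedIntegral {H : Type*} [NormedAddCommGroup H]
    [NormedSpace ℝ H] [CompleteSpace H] {H' : Type*} [NormedAddCommGroup H']
    [NormedSpace ℝ H'] [CompleteSpace H'] {m : SignedMeasure G}
    (hm : IsCompactlySupportedMeasure m) (L : H →L[ℝ] H') {f : G → H} (hf : Continuous f) :
    L (signedIntegral m f) = signedIntegral m (fun g => L (f g)) := by
  obtain ⟨K, hK, hp, hn⟩ := hm.exists_isCompact
  rw [signedIntegral, signedIntegral, map_sub,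
    L.integral_comp_comm (hf.integrable_of_measure_compl_eq_zero hK hp),
    L.integral_comp_comm (hf.integrable_of_measure_compl_eq_zero hK hn)]

end SignedIntegral

section Representation

theorem add_one_sq_le_exp {t : ℝ} (ht : 0 < t) :
    ∃ D : ℝ, 0 ≤ D ∧ ∀ a : ℝ, 0 ≤ a → (a + 1) ^ 2 ≤ D * Real.exp (t * a) := by
  refine ⟨(1 + 2 / t) ^ 2, by positivity, fun a ha => ?_⟩
  have h1 : t / 2 * a + 1 ≤ Real.exp (t / 2 * a) := Real.add_one_le_exp _
  have h2 : Real.exp (t * a) = Real.exp (t / 2 * a) ^ 2 := by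
    rw [← Real.exp_nat_mul]; congr 1; push_cast; ring
  rw [h2, ← mul_pow]
  have h3 : a + 1 ≤ (1 + 2 / t) * (t / 2 * a + 1) := by
    have : (1 + 2 / t) * (t / 2 * a + 1) = t / 2 * a + 1 + a + 2 / t := by
      field_simp
      ring
    rw [this]
    have : 0 ≤ t / 2 * a := by positivity
    have : 0 ≤ 2 / t := by positivity
    linarith
  have h4 : (1 + 2 / t) * (t / 2 * a + 1) ≤ (1 + 2 / t) * Real.exp (t / 2 * a) := by gcongr
  gcongr
  exact h3.trans h4

variable {G : Type u} [Group G] [TopologicalSpace G]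

/-- A representation that is bounded for the semi-norm `‖e v‖`, with locally bounded norms and
continuous orbit maps, extends to the completion. -/
theorem exists_extended_representation {E : Type*} [AddCommGroup E] [Module ℂ E] {H : Type*}
    [NormedAddCommGroup H] [InnerProductSpace ℂ H] [CompleteSpace H] {e : E →ₗ[ℂ] H}
    (he : DenseRange e) (ρ : G →* (E →ₗ[ℂ] E)) {b : G → ℝ} (hb : Continuous b)
    (hb0 : ∀ g, 0 ≤ b g) (hρ : ∀ g v, ‖e (ρ g v)‖ ≤ b g * ‖e v‖)
    (hcont : ∀ v, Continuous fun g => e (ρ g v)) :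
    ∃ π : G →* (H →L[ℂ] H), (∀ g v, π g (e v) = e (ρ g v)) ∧ (∀ g, ‖π g‖ ≤ b g) ∧
      IsStronglyContinuous π := by
  have hbd : ∀ g, ∃ C, ∀ v, ‖(e ∘ₗ ρ g) v‖ ≤ C * ‖e v‖ := fun g => ⟨b g, hρ g⟩
  let A : G → (H →L[ℂ] H) := fun g => (e ∘ₗ ρ g).extendOfNorm e
  have hA : ∀ g v, A g (e v) = e (ρ g v) := fun g v => LinearMap.extendOfNorm_eq he (hbd g) v
  have hext : ∀ S T : H →L[ℂ] H, (∀ v, S (e v) = T (e v)) → S = T := by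
    intro S T h
    ext ξ
    exact congrFun (he.equalizer S.continuous T.continuous (funext h)) ξ
  let π : G →* (H →L[ℂ] H) :=
    { toFun := A
      map_one' := hext _ _ fun v => by simp [hA]
      map_mul' := fun g h => hext _ _ fun v => by simp [hA] }
  have hnorm : ∀ g, ‖π g‖ ≤ b g := by
    intro g
    refine ContinuousLinearMap.opNorm_le_bound _ (hb0 g) fun ξ => ?_
    refine he.induction_on (p := fun ξ => ‖π g ξ‖ ≤ b g * ‖ξ‖) ξ
      (isClosed_le (by fun_prop) (by fun_prop)) fun v => ?_
    change ‖A g (e v)‖ ≤ _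
    rw [hA]
    exact hρ g v
  refine ⟨π, hA, hnorm, fun ξ => ?_⟩
  rw [continuous_iff_continuousAt]
  intro g₀
  rw [Metric.continuousAt_iff']
  intro ε hε
  set B := b g₀ + 1 with hB
  have hBpos : 0 < B := by have := hb0 g₀; linarith
  obtain ⟨v, hv⟩ := Metric.denseRange_iff.1 he ξ (ε / (3 * B)) (by positivity)
  have h1 : ∀ᶠ g in 𝓝 g₀, b g < B := hb.continuousAt.eventually_lt_const (by linarith)
  have h2 : ∀ᶠ g in 𝓝 g₀, dist (e (ρ g v)) (e (ρ g₀ v)) < ε / 3 :=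
    Metric.continuousAt_iff'.1 (hcont v).continuousAt _ (by positivity)
  have h3 : ∀ g, b g < B → dist (π g ξ) (e (ρ g v)) ≤ ε / 3 := by
    intro g hg
    have : e (ρ g v) = π g (e v) := (hA g v).symm
    rw [this, dist_eq_norm, ← map_sub]
    refine ((π g).le_opNorm _).trans ?_
    rw [← dist_eq_norm]
    calc ‖π g‖ * dist ξ (e v) ≤ B * (ε / (3 * B)) := by
          gcongr
          exact (hnorm g).trans hg.le
      _ = ε / 3 := by field_simp
  filter_upwards [h1, h2] with g hg1 hg2
  have h4 := h3 g hg1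
  have h5 := h3 g₀ (by linarith)
  rw [dist_comm] at h5
  have h6 := dist_triangle4 (π g ξ) (e (ρ g v)) (e (ρ g₀ v)) (π g₀ ξ)
  linarith

variable [T2Space G] [MeasurableSpace G] [BorelSpace G]

/-- As `σ` is invariant, it does not distinguish the operators of `π` from those of the trivial
representation on the same `H`, which obeys the growth bound with the same `t`. The latter converge
to the identity, so `σ` takes the value 1 on the projection of `ξ₀`. -/
theorem HasStrongPropertyT.exists_invariant (hG : HasStrongPropertyT G) {l : G → ℝ}
    (hl : IsLengthFunction l) {H : Type u} [NormedAddCommGroup H] [InnerProductSpace ℂ H]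
    [CompleteSpace H] {π : G →* (H →L[ℂ] H)} (hπ : IsStronglyContinuous π) {C : ℝ} (hC : 0 ≤ C)
    (hb : ∀ g, ‖π g‖ ≤ C * (l g + 1) ^ 2) (σ : H →L[ℂ] ℂ) (hσ : ∀ g ξ, σ (π g ξ) = σ ξ)
    {ξ₀ : H} (h₀ : σ ξ₀ = 1) : ∃ η : H, (∀ g, π g η = η) ∧ σ η = 1 := by
  obtain ⟨m, hm, hH⟩ := hG l hl
  obtain ⟨t, ht, h⟩ := hH H
  obtain ⟨D, hD, hDle⟩ := add_one_sq_le_exp ht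
  obtain ⟨T, P, hT, hP, hTP⟩ := h π hπ ⟨C * D, by positivity, fun g => (hb g).trans (by
    rw [mul_assoc]
    gcongr
    exact hDle _ (hl.nonneg g))⟩
  obtain ⟨T', P', hT', hP', hTP'⟩ := h 1 (fun ξ => continuous_const) ⟨1, zero_le_one, fun g => by
    rw [one_mul]
    refine (ContinuousLinearMap.norm_id_le (𝕜 := ℂ) (E := H)).trans ?_
    exact Real.one_le_exp (mul_nonneg ht.le (hl.nonneg g))⟩
  have hlim : ∀ {S : ℕ → H →L[ℂ] H} {Q : H →L[ℂ] H}, Tendsto S atTop (𝓝 Q) →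
      Tendsto (fun n => σ (S n ξ₀)) atTop (𝓝 (σ (Q ξ₀))) := by
    intro S Q hSQ
    have h1 : Continuous fun S : H →L[ℂ] H => σ (S ξ₀) := by fun_prop
    exact (h1.tendsto Q).comp hSQ
  have h1 : ∀ n, σ (T n ξ₀) = σ (T' n ξ₀) := by
    intro n
    have e1 := (hm n).1.map_signedIntegral (σ.restrictScalars ℝ) (hπ ξ₀)
    have e2 := (hm n).1.map_signedIntegral (σ.restrictScalars ℝ) (continuous_const (y := ξ₀))
    simp only [ContinuousLinearMap.coe_restrictScalars', hσ] at e1 e2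
    rw [hT n ξ₀, hT' n ξ₀, e1]
    exact e2.symm
  have h2 : P' ξ₀ = ξ₀ := hP'.2 ξ₀ fun g => rfl
  refine ⟨P ξ₀, hP.1 ξ₀, ?_⟩
  have h3 := hlim hTP
  simp only [h1] at h3
  rw [tendsto_nhds_unique h3 (hlim hTP'), h2, h₀]

/-- The representation `ρ` on `E` carries the semi-norm `‖Φ v‖`, with respect to which its norms
grow at most quadratically. Then strong Property (T) produces almost invariant vectors. -/
theorem HasStrongPropertyT.exists_bounded_orbit (hG : HasStrongPropertyT G) {l : G → ℝ}
    (hl : IsLengthFunction l) {E : Type u} [AddCommGroup E] [Module ℂ E] {N : Type*}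
    [NormedAddCommGroup N] [InnerProductSpace ℂ N] (Φ : E →ₗ[ℂ] N) (ρ : G →* (E →ₗ[ℂ] E))
    {C : ℝ} (hC : 0 ≤ C) (hb : ∀ g v, ‖Φ (ρ g v)‖ ≤ C * (l g + 1) ^ 2 * ‖Φ v‖)
    (hcont : ∀ v g₀, ∀ᶠ g in 𝓝 g₀, ‖Φ (ρ g v - ρ g₀ v)‖ = 0)
    (σ : E →ₗ[ℂ] ℂ) (hσb : ∀ v, ‖σ v‖ ≤ ‖Φ v‖) (hσ : ∀ g v, σ (ρ g v) = σ v)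
    {v₀ : E} (h₀ : σ v₀ = 1) :
    ∃ K : ℝ, 0 ≤ K ∧ ∀ g, ∃ v, ‖Φ v‖ ≤ K ∧ ‖Φ (ρ g v)‖ ≤ K ∧ 1 / 2 ≤ ‖σ v‖ := by
  obtain ⟨H, _, _, _, e, he, hne⟩ := exists_hilbert_completion Φ
  simp only [← hne] at hb hcont hσb ⊢
  have hc : ∀ v, Continuous fun g => e (ρ g v) := by
    intro v
    rw [continuous_iff_continuousAt]
    intro g₀
    refine continuousAt_const.congr (f := fun _ => e (ρ g₀ v)) ?_
    filter_upwards [hcont v g₀] with g hg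
    rw [norm_eq_zero, map_sub, sub_eq_zero] at hg
    exact hg.symm
  have hlc := hl.continuous
  obtain ⟨π, hπe, hπb, hπc⟩ := exists_extended_representation he ρ
    (b := fun g => C * (l g + 1) ^ 2) (by fun_prop) (fun g => by positivity) hb hc
  have hσ' : ∃ D, ∀ v, ‖σ v‖ ≤ D * ‖e v‖ := ⟨1, by simpa using hσb⟩
  set τ : H →L[ℂ] ℂ := σ.extendOfNorm e with hτ
  have hτe : ∀ v, τ (e v) = σ v := LinearMap.extendOfNorm_eq he hσ'
  have hτπ : ∀ g ξ, τ (π g ξ) = τ ξ := fun g ξ =>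
    he.induction_on (p := fun ξ => τ (π g ξ) = τ ξ) ξ (isClosed_eq (by fun_prop) (by fun_prop))
      fun v => by rw [hπe, hτe, hτe, hσ]
  obtain ⟨η, hη, hτη⟩ := hG.exists_invariant hl hπc hC hπb τ hτπ (ξ₀ := e v₀) (by rw [hτe, h₀])
  -- For fixed `g` the three conditions, made strict, are open and hold at `η`, so density provides
  -- `v`. It depends on `g`, the bound does not.
  refine ⟨‖η‖ + 1, by positivity, fun g => ?_⟩
  have h1 : IsOpen {ξ : H | ‖ξ‖ < ‖η‖ + 1} := isOpen_lt (by fun_prop) (by fun_prop)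
  have h2 : IsOpen {ξ : H | ‖π g ξ‖ < ‖η‖ + 1} := isOpen_lt (by fun_prop) (by fun_prop)
  have h3 : IsOpen {ξ : H | 1 / 2 < ‖τ ξ‖} := isOpen_lt (by fun_prop) (by fun_prop)
  obtain ⟨v, hv1, hv2, hv3⟩ := he.exists_mem_open (h1.inter (h2.inter h3))
    ⟨η, by simp, by simp [hη], show 1 / 2 < ‖τ η‖ by rw [hτη]; norm_num⟩
  exact ⟨v, hv1.le, hπe g v ▸ hv2.le, hτe v ▸ hv3.le⟩

end Representation

/-! ### The energy as a Hilbert norm -/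

section MassLinear

variable {V W : Type*}

theorem mass_eq_linearCombination (f : V →₀ ℂ) (S : Set V) :
    mass f S = Finsupp.linearCombination ℂ (S.indicator (1 : V → ℂ)) f := by
  classical
  rw [mass, Finsupp.linearCombination_apply, Finsupp.sum]
  refine Finset.sum_congr rfl fun y _ => ?_
  by_cases hy : y ∈ S <;> simp [hy]

theorem mass_mapDomain (a : V → W) (f : V →₀ ℂ) (S : Set W) :
    mass (f.mapDomain a) S = mass f (a ⁻¹' S) := by
  rw [mass_eq_linearCombination, mass_eq_linearCombination, Finsupp.linearCombination_mapDomain]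
  rfl

end MassLinear

namespace SimpleGraph

variable {V : Type*} {X : SimpleGraph V} {x : V} {f : V →₀ ℂ} {E : ℝ}

/-- A cone of non-zero mass contains a vertex of the finite support, and the level bound in `IsCone`
leaves finitely many cones through each vertex. -/
theorem finite_setOf_isCone_mass_ne_zero (hc : X.Connected) (x : V) (f : V →₀ ℂ) :
    {i : {i // X.IsCone x i} | mass f i.1.2 ≠ 0}.Finite := by
  have h : (⋃ y ∈ f.support,
      (fun n => (n, X.cone x n y)) '' Set.Iic (X.dist x y + 1)).Finite :=
    f.support.finite_toSet.biUnion fun y _ => (Set.finite_Iic _).image _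
  refine Set.Finite.of_finite_image (f := Subtype.val) (h.subset ?_) Subtype.val_injective.injOn
  rintro _ ⟨⟨⟨n, S⟩, y₀, hn, hS⟩, hi, rfl⟩
  dsimp only at hn hS
  subst hS
  obtain ⟨y, hy, hne⟩ := Finset.exists_ne_zero_of_sum_ne_zero hi
  have hyS : y ∈ X.cone x n y₀ := by
    by_contra h
    exact hne (Set.indicator_of_notMem h _)
  refine Set.mem_iUnion₂.2 ⟨y, hy, n, ?_, ?_⟩
  · rw [Set.mem_Iic]
    by_contra! hlt
    have h1 : X.dist x y < n := by omega
    have h2 : y₀ ∈ X.cone x n y := cone_eq_of_mem hyS ▸ mem_cone_self x n y₀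
    rw [cone_eq_singleton hc h1, Set.mem_singleton_iff] at h2
    subst h2
    omega
  · simp only [cone_eq_of_mem hyS]

/-- The family of the masses of the cones, as a vector of a Hilbert space. -/
noncomputable def coneMap (hc : X.Connected) (x : V) :
    (V →₀ ℂ) →ₗ[ℂ] lp (fun _ : {i // X.IsCone x i} => ℂ) 2 where
  toFun f := ⟨fun i => mass f i.1.2,
    (memℓp_zero (finite_setOf_isCone_mass_ne_zero hc x f)).of_exponent_ge zero_le⟩
  map_add' f g := by
    ext i
    simp only [mass_eq_linearCombination, map_add]
    rfl
  map_smul' c f := by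
    ext i
    simp [mass_eq_linearCombination]

theorem energyLE_norm_coneMap (hc : X.Connected) (x : V) (f : V →₀ ℂ) :
    X.EnergyLE x f (‖coneMap hc x f‖ ^ 2) := by
  classical
  intro F hF
  have h := lp.sum_rpow_le_norm_rpow (p := 2) (by simp) (coneMap hc x f)
    (F.subtype (X.IsCone x))
  simp only [ENNReal.toReal_ofNat, Real.rpow_ofNat] at h
  refine le_trans (le_of_eq ?_) h
  exact (Finset.sum_subtype_of_mem (fun i => ‖mass f i.2‖ ^ 2) hF).symm

theorem EnergyLE.norm_coneMap_le (hc : X.Connected) {B : ℝ} (hB : 0 ≤ B)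
    (h : X.EnergyLE x f (B ^ 2)) : ‖coneMap hc x f‖ ≤ B := by
  refine lp.norm_le_of_forall_sum_le (p := 2) (by simp) hB fun s => ?_
  simp only [ENNReal.toReal_ofNat, Real.rpow_ofNat]
  have h1 := h (s.map (Function.Embedding.subtype _)) (by
    intro i hi
    obtain ⟨j, _, rfl⟩ := Finset.mem_map.1 hi
    exact j.2)
  rw [Finset.sum_map] at h1
  exact h1

theorem EnergyLE.mono {E' : ℝ} (h : X.EnergyLE x f E) (hE : E ≤ E') : X.EnergyLE x f E' :=
  fun F hF => (h F hF).trans hE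

theorem EnergyLE.map (a : V ≃ V) (ha : ∀ y z, X.dist (a y) (a z) = X.dist y z)
    (h : X.EnergyLE x f E) : X.EnergyLE (a x) (f.mapDomain a) E := by
  classical
  intro F hF
  let φ : ℕ × Set V → ℕ × Set V := fun i => (i.1, a ⁻¹' i.2)
  have hφ : Function.Injective φ := by
    rintro ⟨n, S⟩ ⟨m, T⟩ h
    simp only [φ, Prod.mk.injEq, a.surjective.preimage_injective.eq_iff] at h
    rw [h.1, h.2]
  have h1 := h (F.image φ) (by
    intro i hi
    obtain ⟨⟨n, S⟩, hj, rfl⟩ := Finset.mem_image.1 hi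
    obtain ⟨y, hn, hS⟩ := hF _ hj
    dsimp only at hn hS
    obtain ⟨y, rfl⟩ := a.surjective y
    rw [ha] at hn
    refine ⟨y, hn, ?_⟩
    ext y'
    have h2 : y' ∈ (φ (n, S)).2 ↔ a y' ∈ X.cone (a x) n (a y) := by
      rw [← hS]
      rfl
    rw [h2]
    refine a.symm.forall_congr fun u => ?_
    obtain ⟨u, rfl⟩ := a.surjective u
    simp only [ha, Equiv.symm_apply_apply, φ])
  rw [Finset.sum_image hφ.injOn] at h1
  simpa only [mass_mapDomain, φ] using h1

end SimpleGraph

/-- A locally compact group with strong Property (T) that acts continuously (i.e. with open vertex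
stabilizers) by isometries on a uniformly fine Gromov-hyperbolic graph has bounded orbits. -/
theorem theorem1p2 {G : Type*} [Group G] [TopologicalSpace G] [IsTopologicalGroup G]
    [LocallyCompactSpace G] [T2Space G] [MeasurableSpace G] [BorelSpace G]
    (hG : HasStrongPropertyT G)
    {V : Type*} (X : SimpleGraph V) (hfine : X.IsUniformlyFine) (hhyp : X.IsGromovHyperbolic)
    [MulAction G V]
    (hisom : ∀ (g : G) (x y : V), X.dist (g • x) (g • y) = X.dist x y)
    (hcont : ∀ x : V, IsOpen (MulAction.stabilizer G x : Set G)) :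
    ∀ x : V, ∃ R : ℕ, ∀ y ∈ MulAction.orbit G x, ∀ z ∈ MulAction.orbit G x, X.dist y z ≤ R := by
  intro x
  obtain ⟨hc, δ, -, hδ⟩ := hhyp
  obtain ⟨M, hM⟩ := hfine.exists_fineBound
  have hT := hδ.thinWalks hc
  have hF := hT.fourPoint hc
  replace hT := hT.mono (by omega : ⌊δ⌋₊ ≤ 4 * ⌊δ⌋₊ + 2)
  obtain ⟨K₁, hK₁⟩ := SimpleGraph.exists_energyLE_change hc hT hF hM
  obtain ⟨K₂, hK₂⟩ := SimpleGraph.exists_dist_mul_norm_sq_mass_univ_le hc hT hF hM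
  have hnear : ∀ (y : V) (g₀ : G), ∀ᶠ g in 𝓝 g₀, g • y = g₀ • y := by
    intro y g₀
    have h1 : Continuous fun g : G => g₀⁻¹ * g := by fun_prop
    filter_upwards [((hcont y).preimage h1).mem_nhds (by simp : g₀ ∈ _)] with g hg
    have h2 : (g₀⁻¹ * g) • y = y := hg
    rw [mul_smul] at h2
    exact (inv_smul_eq_iff.1 h2)
  let l : G → ℝ := fun g => X.dist x (g • x)
  have hl : IsLengthFunction l :=
    { continuous := by
        rw [continuous_iff_continuousAt]
        intro g₀
        refine continuousAt_const.congr (f := fun _ => l g₀) ?_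
        filter_upwards [hnear x g₀] with g hg
        simp only [l, hg]
      nonneg := fun g => Nat.cast_nonneg _
      symm := fun g => by
        have := hisom g x (g⁻¹ • x)
        rw [smul_inv_smul] at this
        simp only [l]
        rw [← this, SimpleGraph.dist_comm]
      mul_le := fun g h => by
        have h1 := hc.dist_triangle (u := x) (v := g • x) (w := (g * h) • x)
        rw [mul_smul, hisom] at h1
        simp only [l, mul_smul]
        exact_mod_cast h1 }
  -- `HasStrongPropertyT` speaks of Hilbert spaces in the universe of `G`, hence functions on `G`,
  -- pushed to the orbit of `x`.
  let push : (G →₀ ℂ) →ₗ[ℂ] (V →₀ ℂ) := Finsupp.lmapDomain ℂ ℂ (fun g => g • x)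
  let ρ : G →* ((G →₀ ℂ) →ₗ[ℂ] (G →₀ ℂ)) :=
    { toFun := fun g => Finsupp.lmapDomain ℂ ℂ (fun h => g * h)
      map_one' := by
        simp only [one_mul]
        exact Finsupp.lmapDomain_id ℂ ℂ
      map_mul' := fun g h => by
        rw [Module.End.mul_eq_comp, ← Finsupp.lmapDomain_comp]
        congr 1
        funext k
        exact mul_assoc g h k }
  have hpush : ∀ g v, push (ρ g v) = (push v).mapDomain (fun y => g • y) := by
    intro g v
    change Finsupp.mapDomain _ (Finsupp.mapDomain _ v) = Finsupp.mapDomain _ (Finsupp.mapDomain _ v)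
    rw [← Finsupp.mapDomain_comp, ← Finsupp.mapDomain_comp]
    congr 1
    funext h
    exact mul_smul g h x
  have hmap : ∀ (g : G) {y : V} {F : V →₀ ℂ} {E : ℝ}, X.EnergyLE y F E →
      X.EnergyLE (g • y) (F.mapDomain fun y => g • y) E :=
    fun g _ _ _ h => h.map (MulAction.toPerm g) (hisom g)
  let σ : (G →₀ ℂ) →ₗ[ℂ] ℂ :=
    Finsupp.linearCombination ℂ (Set.univ.indicator (1 : V → ℂ)) ∘ₗ push
  have hσ : ∀ v, σ v = mass (push v) Set.univ := fun v => (mass_eq_linearCombination _ _).symm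
  have hb : ∀ g v, ‖(SimpleGraph.coneMap hc x ∘ₗ push) (ρ g v)‖ ≤
      K₁ * (l g + 1) ^ 2 * ‖(SimpleGraph.coneMap hc x ∘ₗ push) v‖ := by
    intro g v
    -- The energy of `gf` at `gx` is that of `f` at `x`; only the base point has to be moved back.
    -- As energies are squared norms, `K₁ (l + 1)³ ≤ (K₁ (l + 1)²)²` suffices.
    have h1 := hK₁ x (g • x) _ _ (hmap g (SimpleGraph.energyLE_norm_coneMap hc x (push v)))
    rw [← hpush] at h1
    refine SimpleGraph.EnergyLE.norm_coneMap_le hc (by positivity) (h1.mono ?_)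
    change (K₁ : ℝ) * (l g + 1) ^ 3 * _ ≤ _
    have hl0 : 0 ≤ l g := hl.nonneg g
    have h2 : (K₁ : ℝ) ≤ (K₁ : ℝ) ^ 2 := by exact_mod_cast Nat.le_self_pow two_ne_zero K₁
    rw [mul_pow, mul_pow, ← pow_mul]
    simp only [LinearMap.comp_apply]
    gcongr
    · linarith
    · norm_num
  have hρ : ∀ v g₀, ∀ᶠ g in 𝓝 g₀, ‖(SimpleGraph.coneMap hc x ∘ₗ push) (ρ g v - ρ g₀ v)‖ = 0 := by
    intro v g₀
    have h1 : ∀ᶠ g in 𝓝 g₀, ∀ y ∈ (push v).support, g • y = g₀ • y :=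
      (Filter.eventually_all_finset _).2 fun y _ => hnear y g₀
    filter_upwards [h1] with g hg
    rw [LinearMap.comp_apply, map_sub, hpush, hpush, Finsupp.mapDomain_congr hg, sub_self, map_zero,
      norm_zero]
  have hσb : ∀ v, ‖σ v‖ ≤ ‖(SimpleGraph.coneMap hc x ∘ₗ push) v‖ := by
    intro v
    rw [hσ]
    exact abs_le_of_sq_le_sq' (SimpleGraph.norm_sq_mass_univ_le hc (SimpleGraph.energyLE_norm_coneMap hc x (push v)))
      (norm_nonneg _) |>.2
  have hσρ : ∀ g v, σ (ρ g v) = σ v := by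
    intro g v
    rw [hσ, hσ, hpush, mass_mapDomain, Set.preimage_univ]
  obtain ⟨K, hK0, hK⟩ := hG.exists_bounded_orbit hl (SimpleGraph.coneMap hc x ∘ₗ push) ρ
    (Nat.cast_nonneg K₁) hb hρ σ hσb hσρ (v₀ := Finsupp.single 1 1) (by simp [σ, push])
  have hR : ∀ g : G, (X.dist x (g • x) : ℝ) ≤ 4 * (K₂ * K ^ 2) := by
    intro g
    -- A bound on the energy of `g⁻¹v` at `x` is a bound on the energy of `v` at `gx`.
    obtain ⟨v, h1, h2, h3⟩ := hK g⁻¹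
    have e1 : X.EnergyLE x (push v) (K ^ 2) :=
      (SimpleGraph.energyLE_norm_coneMap hc x _).mono (by gcongr; exact h1)
    have e2 : X.EnergyLE x (push (ρ g⁻¹ v)) (K ^ 2) :=
      (SimpleGraph.energyLE_norm_coneMap hc x _).mono (by gcongr; exact h2)
    have e3 := hmap g e2
    rw [hpush, ← Finsupp.mapDomain_comp] at e3
    have e4 : ((fun y : V => g • y) ∘ fun y => g⁻¹ • y) = id := by
      funext y
      simp
    rw [e4, Finsupp.mapDomain_id] at e3
    have e5 := hK₂ x (g • x) _ _ e1 e3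
    rw [← hσ] at e5
    have e6 : (1 / 2 : ℝ) ^ 2 ≤ ‖σ v‖ ^ 2 := by gcongr
    have e7 : (X.dist x (g • x) : ℝ) * (1 / 2) ^ 2 ≤ X.dist x (g • x) * ‖σ v‖ ^ 2 := by gcongr
    linarith
  refine ⟨⌈4 * (K₂ * K ^ 2)⌉₊, ?_⟩
  rintro _ ⟨g, rfl⟩ _ ⟨h, rfl⟩
  have h1 := hR (g⁻¹ * h)
  rw [← hisom g, mul_smul, smul_inv_smul] at h1
  exact_mod_cast h1.trans (Nat.le_ceil _)
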